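/- **Conventions.** Let $(X,d)$ be a compact metric space, $\mu$ a finite Borel measure on $X$, and $P$ a probability measure on $X$ with $\mu$-density $h$. For $\rho\ge 0$ the level set $M_\rho$ is the support of the measure $B\mapsto\mu(B\cap\{h\ge\rho\})$ (independent of the choice of $h$). $P$ is *normal* if $\mu(M_\rho\setminus\{h\ge\rho\})=0=\mu(\{h>\rho\}\setminus\mathring M_\rho)$ for all $\rho\ge 0$. For $A\subset X$ and $\delta>0$ put $A^{+\delta}=\{x\in X: d(x,A)\le\delta\}$ and $A^{-\delta}=X\setminus (X\setminus A)^{+\delta}$, with $d(x,\emptyset)=\infty$. Let $\mathcal C(A)$ be the set of connected components of $A$ and $\tau^*_A=\min\{d(A',A''):A',A''\in\mathcal C(A),\ A'\ne A''\}$, $\min\emptyset=\infty$. * $P$ has *thick levels of order $\gamma\in(0,1]$ up to the level $\rho^{**}>0$* with constants $c_{\rm thick}\ge 1$ and $\delta_{\rm thick}\in(0,1]$ if $P$ is normal and $\sup_{x\in M_\rho}d(x,M_\rho^{-\delta})\le c_{\rm thick}\,\delta^\gamma$ for all $\delta\in(0,\delta_{\rm thick}]$, $\rho\in[0,\rho^{**}]$.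 * $P$ *can be clustered between $\rho^*\ge 0$ and $\rho^{**}>\rho^*$* if $P$ is normal and, for all $\rho\in[0,\rho^{**}]$: $|\mathcal C(M_\rho)|\in\{1,2\}$; if $|\mathcal C(M_\rho)|=1$ then $\rho\le\rho^*$; if $|\mathcal C(M_\rho)|=2$ then $\rho\ge\rho^*$ and every component of $M_{\rho^{**}}$ is contained in a component of $M_\rho$, the resulting map $\mathcal C(M_{\rho^{**}})\to\mathcal C(M_\rho)$ being bijective. **Statement.** Let $X=[-1,1]\times[-2,2]$ with the supremum metric and Lebesgue measure, and let $P$ be a probability measure on $X$ with a continuous Lebesgue density $h\ge 0$. Assume that there is a $\rho^{**}>0$ such that every $M_\rho$, $\rho\in(0,\rho^{**}]$, is of the form $$M_\rho=\{(x,y)\in X: f^-(x)\le y\le f^+(x)\}$$ with continuous $f^\pm:[-1,1]\to[-1,1]$ and points $x^\pm_-\in(-0.6,-0.4)$, $x^\pm_+\in(0.4,0.6)$ (all depending on $\rho$) such that $f^+$ is strictly increasing on $[-1,x^+_-]$ and on $[0,x^+_+]$ and strictly decreasing on $[x^+_-,0]$ and on $[x^+_+,1]$; $f^-$ is strictly decreasing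 on $[-1,x^-_-]$ and on $[0,x^-_+]$ and strictly increasing on $[x^-_-,0]$ and on $[x^-_+,1]$; $\{f^-<0\}=\{f^+>0\}$ and $\{f^-=0\}=\{f^+=0\}$; and $f^-\le-0.2$, $f^+\ge 0.2$ on $[-0.8,-0.2]\cup[0.2,0.8]$. Assume further that there are $K\in(0,1)$ and $\rho^*\in[0,\rho^{**})$ with $$|h(x,y)-\rho^*-x^2+y^2|\le K(x^2+y^2)$$ for all $(x,y)\in\{h>0\}\cap([-0.2,0.2]\times(-1.1,1.1))$. Finally, assume that $h$ is continuously differentiable on $$A_1=\{h>0\}\cap\big(((-0.7,-0.3)\cup(0.3,0.7))\times((-1.1,-0.2)\cup(0.2,1.1))\big),$$ $$A_2=\{h>0\}\cap\big(((-1,-0.8)\cup(0.8,1))\times((-1.1,0)\cup(0,1.1))\big),$$ $$A_3=\{h>0\}\cap\Big\{(x,y)\in X: x\in(-0.2,0)\cup(0,0.2),\ |y|<\sqrt{\tfrac{1+K}{1-K}}\,|x|\Big\},$$ that $h_y\ne 0$ on $A_1$ and $h_x\ne 0$ on $A_2\cup A_3$, and that for some $C>0$ we have $|h_x|\le C|h_y|$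 on $A_1$ and $|h_y|\le C|h_x|$ on $A_2\cup A_3$. Then $P$ has thick levels of order $\gamma=1$ up to the level $\rho^{**}$ with $\delta_{\rm thick}=0.1$ and $$c_{\rm thick}=1+\max\Big\{C,\sqrt{\tfrac{1+K}{1-K}}\Big\},$$ $P$ can be clustered between $\rho^*$ and $\rho^{**}$, and $$\frac{2}{\sqrt{1+K}}\sqrt\varepsilon\ \le\ \tau^*_{M_{\rho^*+\varepsilon}}\ \le\ \frac{2}{\sqrt{1-K}}\sqrt\varepsilon,\qquad \varepsilon\in(0,\rho^{**}-\rho^*].$$ -/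

import Mathlib

open MeasureTheory Set
open scoped ENNReal

noncomputable section

namespace DensityClustering

section General

variable {X : Type*} [PseudoMetricSpace X]

/-- The `δ`-enlargement `A^{+δ} = {x : d(x, A) ≤ δ}`, with `d(x, ∅) = ∞`. -/
def outerTube (A : Set X) (δ : ℝ) : Set X :=
  {x | Metric.infEDist x A ≤ ENNReal.ofReal δ}

/-- The `δ`-reduction `A^{-δ} = X \ (X \ A)^{+δ}`, computed relative to the space `X`. -/
def innerTube (A : Set X) (δ : ℝ) : Set X :=
  (outerTube Aᶜ δ)ᶜ

/-- `ψ*_A(δ) = sup_{x ∈ A} d(x, A^{-δ})`, with values in `[0, ∞]`; it is `∞` when `A` is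
nonempty and `A^{-δ}` is empty. -/
def psiStar (A : Set X) (δ : ℝ) : ℝ≥0∞ :=
  ⨆ x ∈ A, Metric.infEDist x (innerTube A δ)

/-- The collection `C(A)` of topologically connected components of `A`. -/
def components (A : Set X) : Set (Set X) :=
  {B | ∃ x ∈ A, B = connectedComponentIn A x}

/-- The distance `d(A, B) = inf {d(x, y) : x ∈ A, y ∈ B}` of two sets. -/
def setEDist (A B : Set X) : ℝ≥0∞ :=
  ⨅ x ∈ A, ⨅ y ∈ B, edist x y

/-- `τ*_A`: the smallest distance between two different connected components of `A`
(`∞` if there are no two different components). -/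
def tauStar (A : Set X) : ℝ≥0∞ :=
  ⨅ B ∈ components A, ⨅ B' ∈ components A, ⨅ _ : B ≠ B', setEDist B B'

/-- A partition `𝒜` is persistent in a partition `ℬ`: every cell of `𝒜` is contained in a cell
of `ℬ`, and the resulting cell relating map `𝒜 → ℬ` is bijective. -/
def Persistent (𝒜 ℬ : Set (Set X)) : Prop :=
  ∃ ζ : 𝒜 → ℬ, Function.Bijective ζ ∧ ∀ B : 𝒜, (B : Set X) ⊆ (ζ B : Set X)

variable [MeasurableSpace X]

/-- The density level set `M_ρ` of a `μ`-absolutely continuous `P`: the support of the measure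
`μ_ρ(B) = μ(B ∩ {h ≥ ρ})`, where `h` is the `μ`-density of `P` (any two densities give the same
measure `μ_ρ`). -/
def levelSet (μ P : Measure X) (ρ : ℝ) : Set X :=
  (μ.restrict {x | ENNReal.ofReal ρ ≤ P.rnDeriv μ x}).support

/-- `P` is normal at level `ρ`: `μ(M_ρ \ {h ≥ ρ}) = 0` and `μ({h > ρ} \ interior M_ρ) = 0` for the
`μ`-density `h` of `P`. -/
def NormalAt (μ P : Measure X) (ρ : ℝ) : Prop :=
  μ (levelSet μ P ρ \ {x | ENNReal.ofReal ρ ≤ P.rnDeriv μ x}) = 0 ∧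
    μ ({x | ENNReal.ofReal ρ < P.rnDeriv μ x} \ interior (levelSet μ P ρ)) = 0

/-- `P` is normal if it is normal at every level `ρ ≥ 0`. -/
def Normal (μ P : Measure X) : Prop :=
  ∀ ρ : ℝ, 0 ≤ ρ → NormalAt μ P ρ

/-- `P` can be clustered between `ρs` (that is `ρ*`) and `ρss` (that is `ρ**`). -/
structure CanBeClustered (μ P : Measure X) (ρs ρss : ℝ) : Prop where
  nonneg : 0 ≤ ρs
  lt : ρs < ρss
  absolutelyContinuous : P ≪ μ
  normal : Normal μ P
  card : ∀ ρ ∈ Icc 0 ρss,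
    (components (levelSet μ P ρ)).encard = 1 ∨ (components (levelSet μ P ρ)).encard = 2
  one : ∀ ρ ∈ Icc 0 ρss, (components (levelSet μ P ρ)).encard = 1 → ρ ≤ ρs
  two : ∀ ρ ∈ Icc 0 ρss, (components (levelSet μ P ρ)).encard = 2 →
    ρs ≤ ρ ∧ Persistent (components (levelSet μ P ρss)) (components (levelSet μ P ρ))

/-- `P` has thick levels of order `γ` up to the level `ρss`, with the constants `cthick` and
`δthick`. -/
structure HasThickLevels (μ P : Measure X) (γ ρss cthick δthick : ℝ) : Prop where
  order : γ ∈ Ioc 0 1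
  level_pos : 0 < ρss
  one_le_cthick : 1 ≤ cthick
  δthick_mem : δthick ∈ Ioc 0 1
  absolutelyContinuous : P ≪ μ
  normal : Normal μ P
  thick : ∀ δ ∈ Ioc 0 δthick, ∀ ρ ∈ Icc 0 ρss,
    psiStar (levelSet μ P ρ) δ ≤ ENNReal.ofReal (cthick * δ ^ γ)

end General

/-- The rectangle `[-1, 1] × [-2, 2]`. As a subtype of `ℝ × ℝ` it carries the supremum metric. -/
abbrev Rect : Set (ℝ × ℝ) := Icc (-1) 1 ×ˢ Icc (-2) 2

/-- The two-dimensional Lebesgue measure on the rectangle. -/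
def lebesgue : Measure Rect := (volume : Measure (ℝ × ℝ)).comap Subtype.val

/-- The shape of an upper envelope function with peaks at `a ∈ (-0.6, -0.4)` and
`b ∈ (0.4, 0.6)`: strictly increasing on `[-1, a]` and on `[0, b]`, strictly decreasing on `[a, 0]`
and on `[b, 1]`. -/
structure IsTwoPeaked (f : ℝ → ℝ) (a b : ℝ) : Prop where
  left_mem : a ∈ Ioo (-0.6) (-0.4)
  right_mem : b ∈ Ioo 0.4 0.6
  continuousOn : ContinuousOn f (Icc (-1) 1)
  mapsTo : MapsTo f (Icc (-1) 1) (Icc (-1) 1)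
  strictMonoOn_left : StrictMonoOn f (Icc (-1) a)
  strictAntiOn_left : StrictAntiOn f (Icc a 0)
  strictMonoOn_right : StrictMonoOn f (Icc 0 b)
  strictAntiOn_right : StrictAntiOn f (Icc b 1)

/-- `A` is the set `{(x, y) : f⁻(x) ≤ y ≤ f⁺(x)}` enveloped by two continuous functions
`f⁻, f⁺ : [-1, 1] → [-1, 1]` of the required shape (`fm` is `f⁻`, `fp` is `f⁺`; the monotonicity
pattern of `f⁻` is that of `f⁺` upside down). -/
def IsEnveloped (A : Set Rect) : Prop :=
  ∃ (fm fp : ℝ → ℝ) (am bm ap bp : ℝ),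
    IsTwoPeaked fp ap bp ∧
    IsTwoPeaked (fun x => -fm x) am bm ∧
    (∀ x ∈ Icc (-1 : ℝ) 1, fm x < 0 ↔ 0 < fp x) ∧
    (∀ x ∈ Icc (-1 : ℝ) 1, fm x = 0 ↔ fp x = 0) ∧
    (∀ x ∈ Icc (-0.8 : ℝ) (-0.2) ∪ Icc (0.2 : ℝ) 0.8, fm x ≤ -0.2 ∧ 0.2 ≤ fp x) ∧
    A = {p : Rect | fm p.1.1 ≤ p.1.2 ∧ p.1.2 ≤ fp p.1.1}

/-- The set `{h > 0}`, as a subset of the rectangle. -/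
def posSet (h : ℝ × ℝ → ℝ) : Set (ℝ × ℝ) := {p | p ∈ Rect ∧ 0 < h p}

/-- The region around the four peaks of the envelopes. -/
def region₁ (h : ℝ × ℝ → ℝ) : Set (ℝ × ℝ) :=
  posSet h ∩ ((Ioo (-0.7) (-0.3) ∪ Ioo 0.3 0.7) ×ˢ (Ioo (-1.1) (-0.2) ∪ Ioo 0.2 1.1))

/-- The region around the left and right ends of the level sets. -/
def region₂ (h : ℝ × ℝ → ℝ) : Set (ℝ × ℝ) :=
  posSet h ∩ ((Ioo (-1) (-0.8) ∪ Ioo 0.8 1) ×ˢ (Ioo (-1.1) 0 ∪ Ioo 0 1.1))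

/-- The double cone around the `x`-axis at the saddle point. -/
def region₃ (h : ℝ × ℝ → ℝ) (K : ℝ) : Set (ℝ × ℝ) :=
  posSet h ∩ {p | p.1 ∈ Ioo (-0.2) 0 ∪ Ioo 0 0.2 ∧ |p.2| < √((1 + K) / (1 - K)) * |p.1|}

/-- The partial derivative `∂h/∂x`. -/
def partialX (h : ℝ × ℝ → ℝ) (p : ℝ × ℝ) : ℝ := deriv (fun s => h (s, p.2)) p.1

/-- The partial derivative `∂h/∂y`. -/
def partialY (h : ℝ × ℝ → ℝ) (p : ℝ × ℝ) : ℝ := deriv (fun t => h (p.1, t)) p.2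

end DensityClustering

end

open DensityClustering

/-! For continuous `h` the level set is squeezed, `{h > ρ} ⊆ M_ρ ⊆ {h ≥ ρ}`. This gives normality
and shows that both envelopes, wherever they bound a nonempty fibre, run along the level line `h =
ρ`.

Thickness: differentiability of `h` turns the gradient bounds into slope bounds for the envelopes,
without parametrizing level lines by the implicit function theorem. Around a peak an envelope is
`C`-Lipschitz; at the outer ends it leaves the axis with slope at least `1 / C`. Towards the saddle,
put `κ = √((1 + K) / (1 - K))`. A line of level `ρ > ρ*` stays in the cone of `region₃`, where the
gradient bound gives the same steepness; a line of level `ρ ≤ ρ*` has height at least `|x| / κ` by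
the saddle estimate alone. With `c = max C κ`, a shift by at most `(1 + c) δ` in each coordinate
therefore brings any point of `M_ρ` to the centre of a square of half-side `δ` inside `M_ρ`, which
is a ball of the supremum metric. Reflections reduce the four arcs (left or right, upper or lower)
to one notion, `IsLobe`; the argument is carried by `isLobe_of_level_line`, `IsLobe.exists_isWindow`
and `Envelope.exists_center_of_isLobe`.

Clustering: `h (0, 0) = ρ*`, and the upper envelope is nonnegative at `0` exactly when `ρ ≤ ρ*`.
Each half of `M_ρ` is connected, since a unimodal function is nonnegative on an interval. The halves
meet at the origin if `ρ ≤ ρ*`, and otherwise the line `x = 0` separates them. In the second case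
the gap is realized by the zeros of the envelope nearest to `0`, and at such a zero `x` the saddle
estimate reads `|ε - x ^ 2| ≤ K * x ^ 2`. -/

namespace DensityClustering

open Filter Topology

/-! ### Local slope estimates -/

/-- A continuous function that is locally nondecreasing to the right of each point of `(a, b)`
satisfies `F a ≤ F b`. -/
theorem le_of_forall_eventually_le {F : ℝ → ℝ} {a b : ℝ} (hab : a ≤ b)
    (hF : ContinuousOn F (Icc a b))
    (hloc : ∀ t ∈ Ioo a b, ∀ᶠ s in 𝓝[>] t, F t ≤ F s) : F a ≤ F b := by
  rcases hab.eq_or_lt with rfl | hlt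
  · exact le_rfl
  have key : ∀ t ∈ Ioo a b, F t ≤ F b := by
    intro t ht
    have hc : ContinuousOn F (Icc t b) := hF.mono (Icc_subset_Icc_left ht.1.le)
    have hsub : Icc t b ⊆ {s | F t ≤ F s} := by
      refine IsClosed.Icc_subset_of_forall_exists_gt ?_ (le_refl (F t)) ?_
      · have := hc.preimage_isClosed_of_isClosed isClosed_Icc (isClosed_Ici (a := F t))
        rwa [inter_comm] at this
      · rintro x ⟨hx, hxI⟩ y hy
        have h1 := hloc x ⟨ht.1.trans_le hxI.1, hxI.2⟩
        have h2 : ∀ᶠ s in 𝓝[>] x, s ∈ Ioc x y := Ioc_mem_nhdsGT hy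
        obtain ⟨s, hs, hs'⟩ := (h1.and h2).exists
        exact ⟨s, le_trans hx hs, hs'⟩
    exact hsub ⟨ht.2.le, le_rfl⟩
  -- Nothing is known locally at `a`, where the level line may touch the axis, so this endpoint is
  -- reached by continuity.
  have hca : Tendsto F (𝓝[Ioo a b] a) (𝓝 (F a)) :=
    (hF a ⟨le_rfl, hab⟩).mono_left (nhdsWithin_mono _ Ioo_subset_Icc_self)
  have : (𝓝[Ioo a b] a).NeBot := by
    rw [← mem_closure_iff_nhdsWithin_neBot, closure_Ioo hlt.ne]
    exact ⟨le_rfl, hab⟩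
  exact le_of_tendsto hca (eventually_mem_nhdsWithin.mono key)

/-- Slope bound for a curve on which a differentiable function of the plane is constant. -/
theorem eventually_abs_le_of_const {h : ℝ × ℝ → ℝ} {φ : ℝ → ℝ × ℝ} {t C η r : ℝ}
    (hh : DifferentiableAt ℝ h (φ t)) (hφ : ContinuousAt φ t) (hη : 0 < η) (hC : 0 < C)
    (hconst : ∀ᶠ s in 𝓝 t, h (φ s) = r) (u : ℝ × ℝ →L[ℝ] ℝ) (v : ℝ × ℝ →L[ℝ] ℝ)
    (a b : ℝ) (hb : b ≠ 0) (hab : |a| ≤ C * |b|)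
    (hL : ∀ p, fderiv ℝ h (φ t) p = a * u p + b * v p)
    (hnorm : ∀ p, ‖p‖ ≤ max |u p| |v p|) :
    ∀ᶠ s in 𝓝 t, |v (φ s - φ t)| ≤ (C + η) * |u (φ s - φ t)| := by
  have hb' : 0 < |b| := abs_pos.2 hb
  -- The factor `m` satisfies `m * (1 + C + η) ≤ η` and `m ≤ 1 / 2`, so the error `m * max |u p| |v
  -- p|` can be absorbed whichever coordinate dominates.
  set ε : ℝ := |b| * min (η / (1 + C + η)) (1 / 2) with hε
  have hε0 : 0 < ε := by positivity
  have ho := (hh.hasFDerivAt.isLittleO).def hε0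
  have ho' := hφ.eventually ho
  filter_upwards [ho', hconst] with s hs hr
  rw [hr, hconst.self_of_nhds, sub_self, zero_sub, norm_neg, hL, Real.norm_eq_abs] at hs
  generalize φ s - φ t = p at hs ⊢
  have hn := hnorm p
  have h1 : |b * v p| ≤ |a * u p| + ε * max |u p| |v p| := by
    have : |b * v p| ≤ |a * u p| + |a * u p + b * v p| := by
      have := abs_sub (a * u p + b * v p) (a * u p)
      rw [add_sub_cancel_left] at this
      linarith
    have := mul_le_mul_of_nonneg_left hn hε0.le
    linarith
  rw [abs_mul, abs_mul] at h1
  have h2 : |a| * |u p| ≤ |b| * (C * |u p|) := by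
    calc |a| * |u p| ≤ (C * |b|) * |u p| := by gcongr
      _ = _ := by ring
  set m := min (η / (1 + C + η)) (1 / 2) with hm
  have h3 : |v p| ≤ C * |u p| + m * max |u p| |v p| := by
    have : |b| * |v p| ≤ |b| * (C * |u p| + m * max |u p| |v p|) := by
      rw [hε] at h1; linarith
    exact le_of_mul_le_mul_left this hb'
  have hu := abs_nonneg (u p)
  have hv := abs_nonneg (v p)
  have hm1 : m * (1 + C + η) ≤ η := by
    have : m ≤ η / (1 + C + η) := min_le_left _ _
    rwa [le_div_iff₀ (by positivity)] at this
  have hm0 : 0 < m := by positivity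
  rcases le_total |u p| |v p| with huv | huv
  · rw [max_eq_right huv] at h3
    have hm2 : m ≤ 1 / 2 := min_le_right _ _
    have h5 : (1 - m) * |v p| ≤ (1 - m) * ((C + η) * |u p|) := by
      have : C * |u p| ≤ (1 - m) * (C + η) * |u p| := by
        gcongr
        nlinarith
      nlinarith
    exact le_of_mul_le_mul_left h5 (by linarith)
  · rw [max_eq_left huv] at h3
    have : m ≤ η := by nlinarith
    nlinarith

/-! ### Lobes and windows -/

/-- The right lobe of an envelope, with the quantitative slope bounds at its peak and at its two
ends. -/
structure IsLobe (g : ℝ → ℝ) (b c : ℝ) : Prop where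
  peak_mem : b ∈ Ioo (0.4 : ℝ) 0.6
  mono : MonotoneOn g (Icc 0 b)
  anti : AntitoneOn g (Icc b 1)
  bulk : ∀ x ∈ Icc (0.2 : ℝ) 0.8, 0.2 ≤ g x
  lipschitz : ∀ x ∈ Icc (0.3 : ℝ) 0.7, ∀ y ∈ Icc (0.3 : ℝ) 0.7, |g x - g y| ≤ c * |x - y|
  rising : ∀ x y, 0 ≤ x → x ≤ y → y ≤ 0.2 → 0 ≤ g x → y - x ≤ c * g y
  falling : ∀ x y, 0.8 ≤ y → y ≤ x → x ≤ 1 → 0 ≤ g x → x - y ≤ c * g y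

theorem IsLobe.reverse {g : ℝ → ℝ} {b c : ℝ} (hg : IsLobe g b c) :
    IsLobe (fun x => g (1 - x)) (1 - b) c where
  peak_mem := ⟨by linarith [hg.peak_mem.2], by linarith [hg.peak_mem.1]⟩
  mono := fun x hx y hy hxy => hg.anti ⟨by linarith [hy.2], by linarith [hy.1]⟩
    ⟨by linarith [hx.2], by linarith [hx.1]⟩ (by linarith)
  anti := fun x hx y hy hxy => hg.mono ⟨by linarith [hy.2], by linarith [hy.1]⟩
    ⟨by linarith [hx.2], by linarith [hx.1]⟩ (by linarith)
  bulk := fun x hx => hg.bulk _ ⟨by linarith [hx.2], by linarith [hx.1]⟩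
  lipschitz := fun x hx y hy => by
    have := hg.lipschitz (1 - x) ⟨by linarith [hx.2], by linarith [hx.1]⟩ (1 - y)
      ⟨by linarith [hy.2], by linarith [hy.1]⟩
    rwa [show 1 - x - (1 - y) = -(x - y) by ring, abs_neg] at this
  rising := fun x y h1 h2 h3 h4 => by
    linarith [hg.falling (1 - x) (1 - y) (by linarith) (by linarith) (by linarith) h4]
  falling := fun x y h1 h2 h3 h4 => by
    linarith [hg.rising (1 - x) (1 - y) (by linarith) (by linarith) (by linarith) h4]

/-- On the window of radius `δ` around `z`, the function `g` is at least `δ` and falls below `g x`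
by at most `c * δ`. -/
def IsWindow (g : ℝ → ℝ) (c δ x z : ℝ) : Prop :=
  ∀ s, |s - z| ≤ δ → s ∈ Icc (0 : ℝ) 1 ∧ δ ≤ g s ∧ g x - c * δ ≤ g s

/-- With `y = min (x + c * δ) 0.2`, the window `[y, y + 2 * δ]` lies on the increasing branch, so
`g` is there at least `g y ≥ g x`. The first shift `c * δ` buys height `δ` by the `rising` bound; if
it is cut off at `0.2`, the bulk bound supplies the height. -/
theorem IsLobe.isWindow_rising {g : ℝ → ℝ} {b c δ x : ℝ} (hg : IsLobe g b c) (hc : 0 < c)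
    (hδ : 0 < δ) (hb : 0.2 + 2 * δ ≤ b) (hx0 : 0 ≤ x) (hx : x ≤ 0.2) (hgx : 0 ≤ g x) :
    IsWindow g c δ x (min (x + c * δ) 0.2 + δ) := by
  intro s hs
  rw [abs_le] at hs
  have hp := hg.peak_mem
  have hcδ : 0 < c * δ := by positivity
  set y := min (x + c * δ) 0.2 with hy
  have hxy : x ≤ y := le_min (by linarith) hx
  have hy2 : y ≤ 0.2 := min_le_right _ _
  have hs0 : y ≤ s := by linarith
  have hsb : s ≤ b := by linarith
  have h1 : g y ≤ g s := hg.mono ⟨by linarith, by linarith⟩ ⟨by linarith, hsb⟩ hs0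
  have h2 : g x ≤ g y := hg.mono ⟨hx0, by linarith⟩ ⟨by linarith, by linarith⟩ hxy
  refine ⟨⟨by linarith, by linarith [hp.2]⟩, ?_, by linarith⟩
  refine le_trans ?_ h1
  rcases le_total (x + c * δ) 0.2 with h | h
  · have h3 := hg.rising x y hx0 hxy hy2 hgx
    rw [hy, min_eq_left h] at h3 ⊢
    have : c * δ ≤ c * g (x + c * δ) := by linarith
    exact le_of_mul_le_mul_left this hc
  · rw [hy, min_eq_right h]
    have := hg.bulk 0.2 ⟨le_rfl, by norm_num⟩
    linarith [hp.2]

/-- Moving towards `ξ`, which precedes the peak, cannot lower `g`. Only the parts of the window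
beyond `ξ` or to the left of `x` lose height, and these lie in the Lipschitz zone, so the loss is at
most `c * δ`. The centre depends on `ξ` and not on the peak, hence can serve two lobes at once. -/
theorem IsLobe.isWindow_left {g : ℝ → ℝ} {b c δ ξ x : ℝ} (hg : IsLobe g b c) (hc : 0 < c)
    (hδ : 0 < δ) (hδ' : δ ≤ 0.2) (hξb : ξ ≤ b) (hξ : 0.3 + δ ≤ ξ) (hξ' : ξ + δ ≤ 0.7)
    (hx0 : 0.2 ≤ x) (hx : x ≤ ξ) : IsWindow g c δ x (min (x + δ) ξ) := by
  intro s hs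
  rw [abs_le] at hs
  have hp := hg.peak_mem
  set z := min (x + δ) ξ with hz
  have hz1 : z ≤ ξ := min_le_right _ _
  have hz2 : x ≤ z := le_min (by linarith) hx
  have hs2 : 0.2 ≤ s := by
    rcases le_total (x + δ) ξ with h | h
    · rw [min_eq_left h] at hz; linarith
    · rw [min_eq_right h] at hz; linarith
  have hbulk := hg.bulk s ⟨hs2, by linarith⟩
  refine ⟨⟨by linarith, by linarith⟩, by linarith, ?_⟩
  have hcδ : 0 < c * δ := by positivity
  rcases le_total s ξ with hsξ | hsξ
  · rcases le_total x s with hxs | hxs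
    · have := hg.mono ⟨by linarith, by linarith⟩ ⟨by linarith, by linarith⟩ hxs
      linarith
    · rcases le_total (x + δ) ξ with h | h
      · rw [min_eq_left h] at hz
        have : s = x := by linarith
        rw [this]; linarith
      · rw [min_eq_right h] at hz
        have h1 := hg.lipschitz x ⟨by linarith, by linarith⟩ s ⟨by linarith, by linarith⟩
        rw [abs_of_nonneg (by linarith : 0 ≤ x - s)] at h1
        have h2 := le_abs_self (g x - g s)
        have h3 : c * (x - s) ≤ c * δ := by gcongr; linarith
        linarith
  · have h1 := hg.lipschitz ξ ⟨by linarith, by linarith⟩ s ⟨by linarith, by linarith⟩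
    rw [abs_of_nonpos (by linarith : ξ - s ≤ 0)] at h1
    have h2 := le_abs_self (g ξ - g s)
    have h3 : c * -(ξ - s) ≤ c * δ := by gcongr; linarith
    have h4 : g x ≤ g ξ := hg.mono ⟨by linarith, by linarith⟩ ⟨by linarith, by linarith⟩ hx
    linarith

theorem IsLobe.isWindow_self {g : ℝ → ℝ} {b c δ x : ℝ} (hg : IsLobe g b c) (hc : 0 < c)
    (hδ : 0 < δ) (hδ' : δ ≤ 0.2) (hx0 : 0.3 + δ ≤ x) (hx : x + δ ≤ 0.7) :
    IsWindow g c δ x x := by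
  intro s hs
  have h1 := hg.lipschitz x ⟨by linarith, by linarith⟩ s
    ⟨by linarith [(abs_le.1 hs).1], by linarith [(abs_le.1 hs).2]⟩
  rw [abs_sub_comm x s] at h1
  have h2 := le_abs_self (g x - g s)
  have h3 : c * |s - x| ≤ c * δ := by gcongr
  rw [abs_le] at hs
  have hbulk := hg.bulk s ⟨by linarith, by linarith⟩
  exact ⟨⟨by linarith, by linarith⟩, by linarith, by linarith⟩

/-- Common windows for two lobes, in the part of the unit interval up to the middle of the
peak region. -/
theorem IsLobe.exists_isWindow_left {g₁ g₂ : ℝ → ℝ} {b₁ b₂ c δ ξ x : ℝ}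
    (h₁ : IsLobe g₁ b₁ c) (h₂ : IsLobe g₂ b₂ c) (hc : 1 ≤ c) (hδ : 0 < δ)
    (hξ₁ : ξ ≤ b₁) (hξ₂ : ξ ≤ b₂) (hξ : 0.3 + δ ≤ ξ) (hξ' : 0.2 + 2 * δ ≤ ξ) (hξ6 : ξ + δ ≤ 0.7)
    (hδ' : δ ≤ 0.2) (hx0 : 0 ≤ x) (hx : x + δ ≤ 0.7) (hg₁ : 0 ≤ g₁ x) (hg₂ : 0 ≤ g₂ x) :
    ∃ z, |z - x| ≤ (1 + c) * δ ∧ IsWindow g₁ c δ x z ∧ IsWindow g₂ c δ x z := by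
  have hc0 : 0 < c := by linarith
  have hcδ : 0 < c * δ := by positivity
  rcases le_total x 0.2 with hx2 | hx2
  · refine ⟨_, ?_, h₁.isWindow_rising hc0 hδ (hξ'.trans hξ₁) hx0 hx2 hg₁,
      h₂.isWindow_rising hc0 hδ (hξ'.trans hξ₂) hx0 hx2 hg₂⟩
    have := min_le_left (x + c * δ) 0.2
    have := le_min (by linarith : x ≤ x + c * δ) hx2
    rw [abs_le]; constructor <;> linarith
  rcases le_total x ξ with hxξ | hxξ
  · refine ⟨_, ?_, h₁.isWindow_left hc0 hδ hδ' hξ₁ hξ hξ6 hx2 hxξ,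
      h₂.isWindow_left hc0 hδ hδ' hξ₂ hξ hξ6 hx2 hxξ⟩
    have := min_le_left (x + δ) ξ
    have := le_min (by linarith : x ≤ x + δ) hxξ
    rw [abs_le]; constructor <;> linarith
  · refine ⟨x, by simp only [sub_self, abs_zero]; positivity,
      h₁.isWindow_self hc0 hδ hδ' (by linarith) hx, h₂.isWindow_self hc0 hδ hδ' (by linarith) hx⟩

/-- Common windows for two lobes, of every radius slightly larger than `0.1`. -/
theorem IsLobe.exists_isWindow {g₁ g₂ : ℝ → ℝ} {b₁ b₂ c : ℝ}
    (h₁ : IsLobe g₁ b₁ c) (h₂ : IsLobe g₂ b₂ c) (hc : 1 ≤ c) :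
    ∃ δ₀ > (0.1 : ℝ), ∀ δ ∈ Ioo 0 δ₀, ∀ x ∈ Icc (0 : ℝ) 1, 0 ≤ g₁ x → 0 ≤ g₂ x →
      ∃ z, |z - x| ≤ (1 + c) * δ ∧ IsWindow g₁ c δ x z ∧ IsWindow g₂ c δ x z := by
  have hp₁ := h₁.peak_mem
  have hp₂ := h₂.peak_mem
  -- The peaks lie strictly inside `(0.4, 0.6)`, and `0.4 = 0.2 + 2 * 0.1 = 0.3 + 0.1`; this strict
  -- room allows radii beyond `0.1`.
  obtain ⟨ξ, hξ4, hξ⟩ := exists_between (lt_min hp₁.1 hp₂.1)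
  obtain ⟨ζ, hζ, hζ6⟩ := exists_between (max_lt hp₁.2 hp₂.2)
  have hξ₁ := hξ.le.trans (min_le_left _ _)
  have hξ₂ := hξ.le.trans (min_le_right _ _)
  have hζ₁ := (le_max_left _ _).trans hζ.le
  have hζ₂ := (le_max_right _ _).trans hζ.le
  refine ⟨min (min ((ξ - 0.2) / 2) ((0.8 - ζ) / 2)) 0.11, ?_, ?_⟩
  · refine lt_min (lt_min ?_ ?_) (by norm_num) <;> linarith
  rintro δ ⟨hδ, hδ'⟩ x ⟨hx0, hx1⟩ hg₁ hg₂
  rw [lt_min_iff, lt_min_iff] at hδ'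
  obtain ⟨⟨ha, hb⟩, hd⟩ := hδ'
  rcases le_total x 0.5 with hx | hx
  · exact h₁.exists_isWindow_left h₂ hc hδ hξ₁ hξ₂ (by linarith) (by linarith)
      (by linarith [hp₁.2, hp₂.2]) (by linarith) hx0 (by linarith) hg₁ hg₂
  -- The reflection `t ↦ 1 - t` exchanges the falling end with the rising one and maps the peak
  -- interval to itself.
  · obtain ⟨z, hz, hw₁, hw₂⟩ := h₁.reverse.exists_isWindow_left h₂.reverse (ξ := 1 - ζ) (x := 1 - x)
      hc hδ (by linarith) (by linarith) (by linarith) (by linarith)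
      (by linarith [hp₁.1, hp₂.1]) (by linarith) (by linarith) (by linarith)
      (by simpa using hg₁) (by simpa using hg₂)
    have aux : ∀ g : ℝ → ℝ, IsWindow (fun x => g (1 - x)) c δ (1 - x) z →
        IsWindow g c δ x (1 - z) := by
      intro g hw s hs
      have := hw (1 - s) (by rwa [show 1 - s - z = -(s - (1 - z)) by ring, abs_neg])
      simp only [sub_sub_cancel] at this
      exact ⟨⟨by linarith [this.1.2], by linarith [this.1.1]⟩, this.2⟩
    refine ⟨1 - z, ?_, aux _ hw₁, aux _ hw₂⟩
    rwa [show 1 - z - x = -(z - (1 - x)) by ring, abs_neg]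

/-! ### Lebesgue measure on the rectangle and level sets of a continuous density -/

theorem isFiniteMeasure_lebesgue : IsFiniteMeasure lebesgue := by
  refine ⟨?_⟩
  have hm : MeasurableSet Rect := measurableSet_Icc.prod measurableSet_Icc
  rw [lebesgue, (MeasurableEmbedding.subtype_coe hm).comap_apply, image_univ, Subtype.range_coe]
  exact (isCompact_Icc.prod isCompact_Icc).measure_lt_top

theorem isOpenPosMeasure_lebesgue : lebesgue.IsOpenPosMeasure := by
  refine ⟨fun U hU hne => ?_⟩
  have hm : MeasurableSet Rect := measurableSet_Icc.prod measurableSet_Icc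
  rw [lebesgue, (MeasurableEmbedding.subtype_coe hm).comap_apply]
  obtain ⟨V, hV, rfl⟩ := isOpen_induced_iff.1 hU
  obtain ⟨p, hp⟩ := hne
  -- A relatively open set may sit at the edge of the rectangle, but it always meets the open
  -- rectangle.
  have hcl : p.1 ∈ closure (Ioo (-1 : ℝ) 1 ×ˢ Ioo (-2 : ℝ) 2) := by
    rw [closure_prod_eq, closure_Ioo (by norm_num), closure_Ioo (by norm_num)]
    exact p.2
  obtain ⟨q, hqV, hq⟩ := mem_closure_iff.1 hcl V hV hp
  have hO : IsOpen (V ∩ Ioo (-1 : ℝ) 1 ×ˢ Ioo (-2 : ℝ) 2) := hV.inter (isOpen_Ioo.prod isOpen_Ioo)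
  have hpos : 0 < volume (V ∩ Ioo (-1 : ℝ) 1 ×ˢ Ioo (-2 : ℝ) 2) := hO.measure_pos _ ⟨q, hqV, hq⟩
  refine (hpos.trans_le (measure_mono ?_)).ne'
  rintro r ⟨hrV, hr⟩
  exact ⟨⟨r, ⟨Ioo_subset_Icc_self hr.1, Ioo_subset_Icc_self hr.2⟩⟩, hrV, rfl⟩

section Density

variable {h : ℝ × ℝ → ℝ} {P : Measure Rect}

theorem rnDeriv_ae_eq (hcont : ContinuousOn h Rect)
    (hdens : P = lebesgue.withDensity (fun p => ENNReal.ofReal (h p))) :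
    P.rnDeriv lebesgue =ᵐ[lebesgue] fun p => ENNReal.ofReal (h p) := by
  have := isFiniteMeasure_lebesgue
  rw [hdens]
  refine Measure.rnDeriv_withDensity _ ?_
  exact (ENNReal.continuous_ofReal.comp (continuousOn_iff_continuous_domRestrict.1 hcont)).measurable

theorem levelSet_eq (hcont : ContinuousOn h Rect) (hnonneg : ∀ p ∈ Rect, 0 ≤ h p)
    (hdens : P = lebesgue.withDensity (fun p => ENNReal.ofReal (h p))) (ρ : ℝ) :
    levelSet lebesgue P ρ = (lebesgue.restrict {p : Rect | ρ ≤ h p}).support := by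
  rw [levelSet]
  congr 1
  refine Measure.restrict_congr_set ?_
  filter_upwards [rnDeriv_ae_eq hcont hdens] with p hp
  refine propext ?_
  change ENNReal.ofReal ρ ≤ _ ↔ ρ ≤ h p
  rw [hp, ENNReal.ofReal_le_ofReal_iff (hnonneg p p.2)]

/-- `{h ≥ ρ}` is closed by continuity and carries the whole restricted measure, so it contains the
support. -/
theorem levelSet_subset (hcont : ContinuousOn h Rect) (hnonneg : ∀ p ∈ Rect, 0 ≤ h p)
    (hdens : P = lebesgue.withDensity (fun p => ENNReal.ofReal (h p))) (ρ : ℝ) :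
    levelSet lebesgue P ρ ⊆ {p : Rect | ρ ≤ h p} := by
  have hc : IsClosed {p : Rect | ρ ≤ h p} :=
    isClosed_le continuous_const (continuousOn_iff_continuous_domRestrict.1 hcont)
  rw [levelSet_eq hcont hnonneg hdens]
  exact Measure.support_subset_of_isClosed hc (self_mem_ae_restrict hc.measurableSet)

/-- Every neighbourhood of a point with `h > ρ` contains a smaller one inside `{h > ρ}`, which has
positive measure. -/
theorem subset_levelSet (hcont : ContinuousOn h Rect) (hnonneg : ∀ p ∈ Rect, 0 ≤ h p)
    (hdens : P = lebesgue.withDensity (fun p => ENNReal.ofReal (h p))) (ρ : ℝ) :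
    {p : Rect | ρ < h p} ⊆ levelSet lebesgue P ρ := by
  have := isOpenPosMeasure_lebesgue
  have ho : IsOpen {p : Rect | ρ < h p} :=
    isOpen_lt continuous_const (continuousOn_iff_continuous_domRestrict.1 hcont)
  rw [levelSet_eq hcont hnonneg hdens]
  intro p hp
  rw [Measure.mem_support_iff_forall]
  intro U hU
  have hmem : U ∩ {p : Rect | ρ < h p} ∈ 𝓝 p := inter_mem hU (ho.mem_nhds hp)
  calc 0 < lebesgue (U ∩ {p : Rect | ρ < h p}) := Measure.measure_pos_of_mem_nhds _ hmem
    _ ≤ lebesgue (U ∩ {p : Rect | ρ ≤ h p}) :=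
      measure_mono (inter_subset_inter_right _ fun q (hq : ρ < h q) => hq.le)
    _ ≤ _ := Measure.le_restrict_apply _ _

theorem levelSet_antitone (hcont : ContinuousOn h Rect) (hnonneg : ∀ p ∈ Rect, 0 ≤ h p)
    (hdens : P = lebesgue.withDensity (fun p => ENNReal.ofReal (h p))) :
    Antitone (levelSet lebesgue P) := by
  intro ρ ρ' hρ
  rw [levelSet_eq hcont hnonneg hdens, levelSet_eq hcont hnonneg hdens]
  exact Measure.support_mono (Measure.restrict_mono_set _ fun p hp => hρ.trans hp)

theorem levelSet_zero (hcont : ContinuousOn h Rect) (hnonneg : ∀ p ∈ Rect, 0 ≤ h p)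
    (hdens : P = lebesgue.withDensity (fun p => ENNReal.ofReal (h p))) :
    levelSet lebesgue P 0 = univ := by
  have := isOpenPosMeasure_lebesgue
  rw [levelSet_eq hcont hnonneg hdens, eq_univ_of_forall (s := {p : Rect | 0 ≤ h p})
    (fun p => hnonneg p p.2), Measure.restrict_univ, Measure.support_eq_univ]

theorem normal (hcont : ContinuousOn h Rect) (hnonneg : ∀ p ∈ Rect, 0 ≤ h p)
    (hdens : P = lebesgue.withDensity (fun p => ENNReal.ofReal (h p))) :
    Normal lebesgue P := by
  intro ρ hρ
  have hae := rnDeriv_ae_eq hcont hdens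
  have ho : IsOpen {p : Rect | ρ < h p} :=
    isOpen_lt continuous_const (continuousOn_iff_continuous_domRestrict.1 hcont)
  constructor
  · refine measure_mono_null ?_ hae
    rintro p ⟨hp, hp'⟩ heq
    have h1 : ρ ≤ h p := levelSet_subset hcont hnonneg hdens ρ hp
    refine hp' ?_
    change P.rnDeriv lebesgue p = _ at heq
    rw [mem_ofPred_eq, heq]
    exact ENNReal.ofReal_le_ofReal h1
  · refine measure_mono_null ?_ hae
    rintro p ⟨hp, hp'⟩ heq
    refine hp' (interior_maximal (subset_levelSet hcont hnonneg hdens ρ) ho ?_)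
    change P.rnDeriv lebesgue p = _ at heq
    rw [mem_ofPred_eq, heq, ENNReal.ofReal_lt_ofReal_iff_of_nonneg hρ] at hp
    exact hp

end Density

/-! ### Components -/

section Components

variable {X : Type*} [PseudoMetricSpace X]

theorem components_of_isPreconnected {A : Set X} (hA : IsPreconnected A) (hne : A.Nonempty) :
    components A = {A} := by
  ext B
  constructor
  · rintro ⟨x, hx, rfl⟩
    exact hA.connectedComponentIn hx
  · rintro rfl
    obtain ⟨x, hx⟩ := hne
    exact ⟨x, hx, (hA.connectedComponentIn hx).symm⟩

/-- A component reaching `u > 0` from `u ≤ 0` would contain a zero of `u`, by the intermediate value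
theorem. -/
theorem connectedComponentIn_inter_eq {A : Set X} {u : X → ℝ} (hu : Continuous u)
    (hL : IsPreconnected (A ∩ {x | u x ≤ 0})) (h0 : ∀ x ∈ A, u x ≠ 0) {x : X}
    (hx : x ∈ A) (hx0 : u x ≤ 0) : connectedComponentIn A x = A ∩ {x | u x ≤ 0} := by
  refine Subset.antisymm (fun y hy => ?_)
    (hL.subset_connectedComponentIn ⟨hx, hx0⟩ inter_subset_left)
  have hyA := connectedComponentIn_subset A x hy
  refine ⟨hyA, ?_⟩
  by_contra hlt
  rw [mem_ofPred_eq, not_le] at hlt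
  obtain ⟨z, hz, hz0⟩ := isPreconnected_connectedComponentIn.intermediate_value
    (mem_connectedComponentIn hx) hy hu.continuousOn ⟨hx0, hlt.le⟩
  exact h0 z (connectedComponentIn_subset A x hz) hz0

theorem components_eq_pair {A : Set X} {u : X → ℝ} (hu : Continuous u)
    (hL : IsPreconnected (A ∩ {x | u x ≤ 0})) (hR : IsPreconnected (A ∩ {x | 0 ≤ u x}))
    (h0 : ∀ x ∈ A, u x ≠ 0)
    (hLne : (A ∩ {x | u x ≤ 0}).Nonempty) (hRne : (A ∩ {x | 0 ≤ u x}).Nonempty) :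
    components A = {A ∩ {x | u x ≤ 0}, A ∩ {x | 0 ≤ u x}} := by
  have hl : ∀ x ∈ A, u x ≤ 0 → connectedComponentIn A x = A ∩ {x | u x ≤ 0} :=
    fun x hx hx0 => connectedComponentIn_inter_eq hu hL h0 hx hx0
  have hr : ∀ x ∈ A, 0 ≤ u x → connectedComponentIn A x = A ∩ {x | 0 ≤ u x} := fun x hx hx0 => by
    have := connectedComponentIn_inter_eq (A := A) (u := fun x => -u x) hu.neg (x := x)
      (by simpa using hR) (by simpa using h0) hx (by simpa using hx0)
    simpa using this
  ext B
  constructor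
  · rintro ⟨x, hx, rfl⟩
    rcases le_total (u x) 0 with h | h
    · exact Or.inl (hl x hx h)
    · exact Or.inr (hr x hx h)
  · rintro (rfl | rfl)
    · obtain ⟨x, hx, hx0⟩ := hLne
      exact ⟨x, hx, (hl x hx hx0).symm⟩
    · obtain ⟨x, hx, hx0⟩ := hRne
      exact ⟨x, hx, (hr x hx hx0).symm⟩

theorem inter_le_ne_inter_ge {Y : Type*} {A : Set Y} {u : Y → ℝ} (h0 : ∀ x ∈ A, u x ≠ 0)
    (hLne : (A ∩ {x | u x ≤ 0}).Nonempty) :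
    A ∩ {x | u x ≤ 0} ≠ A ∩ {x | 0 ≤ u x} := by
  intro heq
  obtain ⟨x, hx⟩ := hLne
  have hx' := hx
  rw [heq] at hx'
  exact h0 x hx.1 (le_antisymm hx.2 hx'.2)

theorem persistent_pair {Y : Type*} {L R L' R' : Set Y} (hne : L ≠ R) (hne' : L' ≠ R') (hL : L ⊆ L')
    (hR : R ⊆ R') : Persistent {L, R} {L', R'} := by
  classical
  let ζ : ({L, R} : Set (Set Y)) → ({L', R'} : Set (Set Y)) := fun B =>
    if (B : Set Y) = L then ⟨L', by simp⟩ else ⟨R', by simp⟩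
  have hζL : ζ ⟨L, by simp⟩ = ⟨L', by simp⟩ := by simp [ζ]
  have hζR : ζ ⟨R, by simp⟩ = ⟨R', by simp⟩ := by simp [ζ, hne.symm]
  refine ⟨ζ, ⟨?_, ?_⟩, ?_⟩
  · rintro ⟨B, rfl | rfl⟩ ⟨B', rfl | rfl⟩ heq
    · rfl
    · rw [hζL, hζR] at heq
      exact absurd (congrArg Subtype.val heq) hne'
    · rw [hζL, hζR] at heq
      exact absurd (congrArg Subtype.val heq).symm hne'
    · rfl
  · rintro ⟨B, rfl | rfl⟩
    · exact ⟨_, hζL⟩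
    · exact ⟨_, hζR⟩
  · rintro ⟨B, rfl | rfl⟩
    · rw [hζL]; exact hL
    · rw [hζR]; exact hR

theorem setEDist_comm (A B : Set X) : setEDist A B = setEDist B A := by
  rw [setEDist, setEDist, iInf₂_comm]
  simp_rw [edist_comm]

theorem tauStar_of_components_eq_pair {A L R : Set X} (hne : L ≠ R)
    (hA : components A = {L, R}) : tauStar A = setEDist L R := by
  rw [tauStar, hA]
  apply le_antisymm
  · exact (iInf₂_le L (by simp)).trans ((iInf₂_le R (by simp)).trans (iInf_le _ hne))
  · refine le_iInf₂ fun B hB => le_iInf₂ fun B' hB' => le_iInf fun hBB' => ?_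
    rcases hB with rfl | rfl <;> rcases hB' with rfl | rfl
    · exact absurd rfl hBB'
    · exact le_rfl
    · exact (setEDist_comm _ _).le
    · exact absurd rfl hBB'

end Components

/-! ### Enveloped sets, their components and their gap -/

theorem IsTwoPeaked.reflect {f : ℝ → ℝ} {a b : ℝ} (hf : IsTwoPeaked f a b) :
    IsTwoPeaked (fun x => f (-x)) (-b) (-a) where
  left_mem := ⟨by linarith [hf.right_mem.2], by linarith [hf.right_mem.1]⟩
  right_mem := ⟨by linarith [hf.left_mem.2], by linarith [hf.left_mem.1]⟩
  continuousOn := hf.continuousOn.comp continuousOn_neg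
    fun x hx => ⟨by linarith [hx.2], by linarith [hx.1]⟩
  mapsTo := fun x hx => hf.mapsTo (x := -x) ⟨by linarith [hx.2], by linarith [hx.1]⟩
  strictMonoOn_left := fun x hx y hy hxy => hf.strictAntiOn_right
    ⟨by linarith [hy.2], by linarith [hy.1]⟩ ⟨by linarith [hx.2], by linarith [hx.1]⟩
    (by linarith)
  strictAntiOn_left := fun x hx y hy hxy => hf.strictMonoOn_right
    ⟨by linarith [hy.2], by linarith [hy.1]⟩ ⟨by linarith [hx.2], by linarith [hx.1]⟩
    (by linarith)
  strictMonoOn_right := fun x hx y hy hxy => hf.strictAntiOn_left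
    ⟨by linarith [hy.2], by linarith [hy.1]⟩ ⟨by linarith [hx.2], by linarith [hx.1]⟩
    (by linarith)
  strictAntiOn_right := fun x hx y hy hxy => hf.strictMonoOn_left
    ⟨by linarith [hy.2], by linarith [hy.1]⟩ ⟨by linarith [hx.2], by linarith [hx.1]⟩
    (by linarith)

theorem ordConnected_of_unimodal {f : ℝ → ℝ} {u v w : ℝ} (hm : MonotoneOn f (Icc u v))
    (ha : AntitoneOn f (Icc v w)) : OrdConnected {t | t ∈ Icc u w ∧ 0 ≤ f t} := by
  refine ⟨?_⟩
  rintro x ⟨hx, hfx⟩ y ⟨hy, hfy⟩ t ⟨hxt, hty⟩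
  refine ⟨⟨hx.1.trans hxt, hty.trans hy.2⟩, ?_⟩
  rcases le_total t v with htv | htv
  · exact hfx.trans (hm ⟨hx.1, hxt.trans htv⟩ ⟨hx.1.trans hxt, htv⟩ hxt)
  · exact hfy.trans (ha ⟨htv, hty.trans hy.2⟩ ⟨htv.trans hty, hy.2⟩ hty)

/-- The set between two continuous graphs over a preconnected base is preconnected. -/
theorem isPreconnected_between {S : Set ℝ} {f g : ℝ → ℝ} (hS : IsPreconnected S)
    (hSI : S ⊆ Icc (-1) 1) (hf : ContinuousOn f (Icc (-1) 1)) (hg : ContinuousOn g (Icc (-1) 1))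
    (hfm : MapsTo f (Icc (-1) 1) (Icc (-1) 1)) (hgm : MapsTo g (Icc (-1) 1) (Icc (-1) 1))
    (hfg : ∀ t ∈ S, f t ≤ g t) :
    IsPreconnected {p : Rect | p.1.1 ∈ S ∧ f p.1.1 ≤ p.1.2 ∧ p.1.2 ≤ g p.1.1} := by
  rw [← Topology.IsInducing.subtypeVal.isPreconnected_image]
  -- The set is the continuous image of `S ×ˢ Icc (-1) 1` under clamping the ordinate between the
  -- two graphs.
  have himg : Subtype.val '' {p : Rect | p.1.1 ∈ S ∧ f p.1.1 ≤ p.1.2 ∧ p.1.2 ≤ g p.1.1} =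
      (fun q : ℝ × ℝ => (q.1, max (f q.1) (min q.2 (g q.1)))) '' (S ×ˢ Icc (-1) 1) := by
    ext ⟨x, y⟩
    constructor
    · rintro ⟨p, ⟨hpS, h1, h2⟩, hp⟩
      rw [hp] at hpS h1 h2
      refine ⟨(x, y), ⟨hpS, (hfm (hSI hpS)).1.trans h1, h2.trans (hgm (hSI hpS)).2⟩, ?_⟩
      simp only [min_eq_left h2, max_eq_right h1]
    · rintro ⟨⟨s, r⟩, ⟨hs, hr⟩, heq⟩
      simp only [Prod.mk.injEq] at heq
      obtain ⟨rfl, rfl⟩ := heq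
      have h1 : f s ≤ max (f s) (min r (g s)) := le_max_left _ _
      have h2 : max (f s) (min r (g s)) ≤ g s := max_le (hfg s hs) (min_le_right _ _)
      have h3 : -1 ≤ f s := (hfm (hSI hs)).1
      have h4 : g s ≤ 1 := (hgm (hSI hs)).2
      have hmem : (s, max (f s) (min r (g s))) ∈ Rect :=
        ⟨hSI hs, by simp only; linarith, by simp only; linarith⟩
      exact ⟨⟨_, hmem⟩, ⟨hs, h1, h2⟩, rfl⟩
  rw [himg]
  refine (hS.prod isPreconnected_Icc).image _ ?_
  have hfst : MapsTo Prod.fst (S ×ˢ Icc (-1 : ℝ) 1) (Icc (-1 : ℝ) 1) := fun q hq => hSI hq.1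
  have hf' := hf.comp continuousOn_fst hfst
  have hg' := hg.comp continuousOn_fst hfst
  exact continuousOn_fst.prodMk (hf'.sup (continuousOn_snd.inf hg'))

/-- The data witnessing that a set is enveloped by two functions. -/
structure Envelope (A : Set Rect) (fm fp : ℝ → ℝ) (am bm ap bp : ℝ) : Prop where
  upper : IsTwoPeaked fp ap bp
  lower : IsTwoPeaked (fun x => -fm x) am bm
  neg_iff : ∀ x ∈ Icc (-1 : ℝ) 1, fm x < 0 ↔ 0 < fp x
  zero_iff : ∀ x ∈ Icc (-1 : ℝ) 1, fm x = 0 ↔ fp x = 0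
  bulk : ∀ x ∈ Icc (-0.8 : ℝ) (-0.2) ∪ Icc (0.2 : ℝ) 0.8, fm x ≤ -0.2 ∧ 0.2 ≤ fp x
  eq : A = {p : Rect | fm p.1.1 ≤ p.1.2 ∧ p.1.2 ≤ fp p.1.1}

theorem IsEnveloped.exists_envelope {A : Set Rect} (hA : IsEnveloped A) :
    ∃ fm fp am bm ap bp, Envelope A fm fp am bm ap bp := by
  obtain ⟨fm, fp, am, bm, ap, bp, h1, h2, h3, h4, h5, h6⟩ := hA
  exact ⟨fm, fp, am, bm, ap, bp, h1, h2, h3, h4, h5, h6⟩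

/-- The point `(x, 0)` of the rectangle. -/
def axisPoint (x : ℝ) (hx : x ∈ Icc (-1 : ℝ) 1) : Rect :=
  ⟨(x, 0), hx, by norm_num, by norm_num⟩

namespace Envelope

variable {A : Set Rect} {fm fp : ℝ → ℝ} {am bm ap bp : ℝ}

theorem nonpos_iff (e : Envelope A fm fp am bm ap bp) {x : ℝ} (hx : x ∈ Icc (-1 : ℝ) 1) :
    fm x ≤ 0 ↔ 0 ≤ fp x := by
  rw [le_iff_lt_or_eq, le_iff_lt_or_eq, e.neg_iff x hx, e.zero_iff x hx, eq_comm (a := (0 : ℝ))]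

theorem mem_iff (e : Envelope A fm fp am bm ap bp) {p : Rect} :
    p ∈ A ↔ fm p.1.1 ≤ p.1.2 ∧ p.1.2 ≤ fp p.1.1 := by
  rw [e.eq]; rfl

theorem nonneg_of_mem (e : Envelope A fm fp am bm ap bp) {p : Rect} (hp : p ∈ A) :
    0 ≤ fp p.1.1 := by
  rw [e.mem_iff] at hp
  by_contra hneg
  have := mt (e.nonpos_iff p.2.1).1 hneg
  linarith [hp.1.trans hp.2]

theorem axisPoint_mem (e : Envelope A fm fp am bm ap bp) {x : ℝ} (hx : x ∈ Icc (-1 : ℝ) 1)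
    (h0 : 0 ≤ fp x) : axisPoint x hx ∈ A :=
  e.mem_iff.2 ⟨(e.nonpos_iff hx).2 h0, h0⟩

theorem inter_eq (e : Envelope A fm fp am bm ap bp) (I : Set ℝ) :
    A ∩ {p : Rect | p.1.1 ∈ I} =
      {p : Rect | p.1.1 ∈ {t | t ∈ I ∩ Icc (-1) 1 ∧ 0 ≤ fp t} ∧
        fm p.1.1 ≤ p.1.2 ∧ p.1.2 ≤ fp p.1.1} := by
  ext p
  constructor
  · rintro ⟨hp, hpI⟩
    exact ⟨⟨⟨hpI, p.2.1⟩, e.nonneg_of_mem hp⟩, e.mem_iff.1 hp⟩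
  · rintro ⟨⟨⟨hpI, -⟩, -⟩, hp⟩
    exact ⟨e.mem_iff.2 hp, hpI⟩

theorem isPreconnected_inter (e : Envelope A fm fp am bm ap bp) {I : Set ℝ}
    (hI : IsPreconnected {t | t ∈ I ∩ Icc (-1) 1 ∧ 0 ≤ fp t}) :
    IsPreconnected (A ∩ {p : Rect | p.1.1 ∈ I}) := by
  rw [e.inter_eq]
  refine isPreconnected_between hI (fun t ht => ht.1.2) ?_ e.upper.continuousOn ?_
    e.upper.mapsTo ?_
  · exact e.lower.continuousOn.neg.congr fun x _ => (neg_neg (fm x)).symm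
  · intro x hx
    have := e.lower.mapsTo hx
    exact ⟨by linarith [this.2], by linarith [this.1]⟩
  · intro t ht
    exact ((e.nonpos_iff ht.1.2).2 ht.2).trans ht.2

theorem isPreconnected_right (e : Envelope A fm fp am bm ap bp) :
    IsPreconnected (A ∩ {p : Rect | 0 ≤ p.1.1}) := by
  refine e.isPreconnected_inter (I := Ici 0) ?_
  have h := ordConnected_of_unimodal e.upper.strictMonoOn_right.monotoneOn
    e.upper.strictAntiOn_right.antitoneOn
  have hI : Ici (0 : ℝ) ∩ Icc (-1) 1 = Icc 0 1 := by
    ext t; simp only [mem_inter_iff, mem_Ici, mem_Icc]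
    exact ⟨fun h => ⟨h.1, h.2.2⟩, fun h => ⟨h.1, by linarith, h.2⟩⟩
  rw [hI]
  exact h.isPreconnected

theorem isPreconnected_left (e : Envelope A fm fp am bm ap bp) :
    IsPreconnected (A ∩ {p : Rect | p.1.1 ≤ 0}) := by
  refine e.isPreconnected_inter (I := Iic 0) ?_
  have h := ordConnected_of_unimodal e.upper.strictMonoOn_left.monotoneOn
    e.upper.strictAntiOn_left.antitoneOn
  have hI : Iic (0 : ℝ) ∩ Icc (-1) 1 = Icc (-1) 0 := by
    ext t; simp only [mem_inter_iff, mem_Iic, mem_Icc]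
    exact ⟨fun h => ⟨h.2.1, h.1⟩, fun h => ⟨h.2, h.1, by linarith⟩⟩
  rw [hI]
  exact h.isPreconnected

theorem nonempty_right (e : Envelope A fm fp am bm ap bp) :
    (A ∩ {p : Rect | 0 ≤ p.1.1}).Nonempty := by
  have h5 := (e.bulk 0.5 (Or.inr ⟨by norm_num, by norm_num⟩)).2
  exact ⟨axisPoint 0.5 ⟨by norm_num, by norm_num⟩, e.axisPoint_mem _ (by linarith),
    show (0 : ℝ) ≤ 0.5 by norm_num⟩

theorem nonempty_left (e : Envelope A fm fp am bm ap bp) :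
    (A ∩ {p : Rect | p.1.1 ≤ 0}).Nonempty := by
  have h5 := (e.bulk (-0.5) (Or.inl ⟨by norm_num, by norm_num⟩)).2
  exact ⟨axisPoint (-0.5) ⟨by norm_num, by norm_num⟩, e.axisPoint_mem _ (by linarith),
    show (-0.5 : ℝ) ≤ 0 by norm_num⟩

theorem components_of_nonneg (e : Envelope A fm fp am bm ap bp) (h0 : 0 ≤ fp 0) :
    components A = {A} := by
  have hz : axisPoint 0 ⟨by norm_num, by norm_num⟩ ∈ A := e.axisPoint_mem _ h0
  refine components_of_isPreconnected ?_ ⟨_, hz⟩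
  have hu := IsPreconnected.union (axisPoint 0 ⟨by norm_num, by norm_num⟩)
    (s := A ∩ {p : Rect | p.1.1 ≤ 0}) (t := A ∩ {p : Rect | 0 ≤ p.1.1})
    ⟨hz, le_refl (0 : ℝ)⟩ ⟨hz, le_refl (0 : ℝ)⟩ e.isPreconnected_left e.isPreconnected_right
  have huniv : {p : Rect | p.1.1 ≤ 0} ∪ {p : Rect | 0 ≤ p.1.1} = univ :=
    eq_univ_of_forall fun p : Rect => le_total p.1.1 0
  rwa [← inter_union_distrib_left, huniv, inter_univ] at hu

theorem ne_zero_of_neg (e : Envelope A fm fp am bm ap bp) (h0 : fp 0 < 0) :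
    ∀ p ∈ A, p.1.1 ≠ 0 := by
  intro p hp hp0
  have := e.nonneg_of_mem hp
  rw [hp0] at this
  linarith

theorem components_of_neg (e : Envelope A fm fp am bm ap bp) (h0 : fp 0 < 0) :
    components A = {A ∩ {p : Rect | p.1.1 ≤ 0}, A ∩ {p : Rect | 0 ≤ p.1.1}} :=
  components_eq_pair (u := fun p : Rect => p.1.1) (continuous_fst.comp continuous_subtype_val)
    e.isPreconnected_left e.isPreconnected_right (e.ne_zero_of_neg h0) e.nonempty_left
    e.nonempty_right

theorem left_ne_right (e : Envelope A fm fp am bm ap bp) (h0 : fp 0 < 0) :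
    A ∩ {p : Rect | p.1.1 ≤ 0} ≠ A ∩ {p : Rect | 0 ≤ p.1.1} :=
  inter_le_ne_inter_ge (e.ne_zero_of_neg h0) e.nonempty_left

/-- The gap between the two components of an enveloped set is attained on the horizontal axis. -/
theorem exists_tauStar_eq (e : Envelope A fm fp am bm ap bp) (h0 : fp 0 < 0) :
    ∃ l ∈ Ioo (-0.2 : ℝ) 0, ∃ r ∈ Ioo (0 : ℝ) 0.2, fp l = 0 ∧ fp r = 0 ∧
      tauStar A = ENNReal.ofReal (r - l) := by
  have hr2 := (e.bulk 0.2 (Or.inr ⟨by norm_num, by norm_num⟩)).2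
  have hl2 := (e.bulk (-0.2) (Or.inl ⟨by norm_num, by norm_num⟩)).2
  have hb := e.upper.right_mem
  have ha := e.upper.left_mem
  obtain ⟨r, hr, hfr⟩ := intermediate_value_Ioo (show (0 : ℝ) ≤ 0.2 by norm_num)
    (e.upper.continuousOn.mono (Icc_subset_Icc (by norm_num) (by norm_num)))
    (show (0 : ℝ) ∈ Ioo (fp 0) (fp 0.2) from ⟨h0, by linarith⟩)
  obtain ⟨l, hl, hfl⟩ := intermediate_value_Ioo' (show (-0.2 : ℝ) ≤ 0 by norm_num)
    (e.upper.continuousOn.mono (Icc_subset_Icc (by norm_num) (by norm_num)))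
    (show (0 : ℝ) ∈ Ioo (fp 0) (fp (-0.2)) from ⟨h0, by linarith⟩)
  refine ⟨l, hl, r, hr, hfl, hfr, ?_⟩
  rw [tauStar_of_components_eq_pair (e.left_ne_right h0) (e.components_of_neg h0)]
  have hlI : l ∈ Icc (-1 : ℝ) 1 := ⟨by linarith [hl.1], by linarith [hl.2]⟩
  have hrI : r ∈ Icc (-1 : ℝ) 1 := ⟨by linarith [hr.1], by linarith [hr.2]⟩
  apply le_antisymm
  · refine (iInf₂_le (axisPoint l hlI) ⟨e.axisPoint_mem hlI hfl.ge, hl.2.le⟩).trans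
      ((iInf₂_le (axisPoint r hrI) ⟨e.axisPoint_mem hrI hfr.ge, hr.1.le⟩).trans ?_)
    rw [edist_dist]
    refine ENNReal.ofReal_le_ofReal ?_
    rw [Subtype.dist_eq, Prod.dist_eq]
    refine max_le ?_ ?_
    · rw [Real.dist_eq]
      change |l - r| ≤ _
      rw [abs_of_nonpos (by linarith [hl.2, hr.1])]
      linarith
    · change dist (0 : ℝ) 0 ≤ _
      rw [dist_self]
      linarith [hl.2, hr.1]
  · refine le_iInf₂ fun p hp => le_iInf₂ fun q hq => ?_
    rw [edist_dist]
    refine ENNReal.ofReal_le_ofReal ?_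
    -- On `(l, 0]` the envelope is below its zero value at `l`, so no point of `A` lies over it;
    -- similarly for `[0, r)`.
    have hpl : p.1.1 ≤ l := by
      by_contra hlt
      rw [not_le] at hlt
      have hp0 : p.1.1 ≤ 0 := hp.2
      have := e.upper.strictAntiOn_left ⟨by linarith [hl.1, ha.2], hl.2.le⟩
        ⟨by linarith [hl.1, ha.2], hp0⟩ hlt
      linarith [e.nonneg_of_mem hp.1]
    have hqr : r ≤ q.1.1 := by
      by_contra hlt
      rw [not_le] at hlt
      have hq0 : 0 ≤ q.1.1 := hq.2
      have := e.upper.strictMonoOn_right ⟨hq0, by linarith [hr.2, hb.1]⟩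
        ⟨hr.1.le, by linarith [hr.2, hb.1]⟩ hlt
      linarith [e.nonneg_of_mem hq.1]
    rw [Subtype.dist_eq, Prod.dist_eq]
    refine le_trans ?_ (le_max_left _ _)
    rw [dist_comm, Real.dist_eq]
    exact le_trans (by linarith) (le_abs_self _)

end Envelope

/-! ### Envelopes are level lines -/

section LevelLines

variable {h : ℝ × ℝ → ℝ} {A : Set Rect} {ρ : ℝ}

/-- A point of a level set that is the end of a vertical segment outside of it lies on the level
line. -/
theorem eq_of_vertical_boundary (hcont : ContinuousOn h Rect) (hsub : A ⊆ {p : Rect | ρ ≤ h p})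
    (hsup : {p : Rect | ρ < h p} ⊆ A) {x y σ : ℝ} (hx : x ∈ Icc (-1 : ℝ) 1)
    (hy : y ∈ Icc (-1 : ℝ) 1) (hσ : σ ∈ Icc (-1 : ℝ) 1)
    (hmem : ∀ p : Rect, p.1 = (x, y) → p ∈ A)
    (hnot : ∀ p : Rect, ∀ s ∈ Ioo (0 : ℝ) 1, p.1 = (x, y + s * σ) → p ∉ A) : h (x, y) = ρ := by
  -- Envelopes take values in `[-1, 1]` while the rectangle has half-height `2`, so a unit vertical
  -- segment still fits. Outside `A` one has `h ≤ ρ`, and this passes to the limit.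
  have hR : ∀ s ∈ Icc (0 : ℝ) 1, (x, y + s * σ) ∈ Rect := fun s hs =>
    ⟨hx, by nlinarith [hy.1, hσ.1, hs.1, hs.2], by nlinarith [hy.2, hσ.2, hs.1, hs.2]⟩
  have hR0 : (x, y) ∈ Rect := by simpa using hR 0 ⟨le_rfl, zero_le_one⟩
  refine le_antisymm ?_ (hsub (hmem ⟨(x, y), hR0⟩ rfl))
  have hc : ContinuousOn (fun s : ℝ => h (x, y + s * σ)) (Icc 0 1) :=
    hcont.comp (by fun_prop) hR
  have hlim : Tendsto (fun s : ℝ => h (x, y + s * σ)) (𝓝[Ioo 0 1] 0) (𝓝 (h (x, y))) := by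
    have := (hc 0 ⟨le_rfl, zero_le_one⟩).mono_left (nhdsWithin_mono _ Ioo_subset_Icc_self)
    simpa using this
  have : (𝓝[Ioo (0 : ℝ) 1] 0).NeBot := by
    rw [← mem_closure_iff_nhdsWithin_neBot, closure_Ioo zero_ne_one]
    exact ⟨le_rfl, zero_le_one⟩
  refine le_of_tendsto hlim (eventually_mem_nhdsWithin.mono fun s hs => ?_)
  by_contra hlt
  rw [not_le] at hlt
  have hs' := hR s (Ioo_subset_Icc_self hs)
  exact hnot ⟨_, hs'⟩ s hs rfl (hsup hlt)

variable {fm fp : ℝ → ℝ} {am bm ap bp : ℝ}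

theorem Envelope.eq_on_upper (e : Envelope A fm fp am bm ap bp) (hcont : ContinuousOn h Rect)
    (hsub : A ⊆ {p : Rect | ρ ≤ h p}) (hsup : {p : Rect | ρ < h p} ⊆ A) {x : ℝ}
    (hx : x ∈ Icc (-1 : ℝ) 1) (h0 : 0 ≤ fp x) : h (x, fp x) = ρ := by
  refine eq_of_vertical_boundary hcont hsub hsup hx (e.upper.mapsTo hx)
    (σ := 1) ⟨by norm_num, le_rfl⟩ ?_ ?_
  · rintro ⟨p, hp⟩ rfl
    exact e.mem_iff.2 ⟨((e.nonpos_iff hx).2 h0).trans h0, le_rfl⟩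
  · rintro ⟨p, hp⟩ s hs rfl hpA
    have h1 : fp x + s * 1 ≤ fp x := (e.mem_iff.1 hpA).2
    linarith [hs.1]

theorem Envelope.eq_on_lower (e : Envelope A fm fp am bm ap bp) (hcont : ContinuousOn h Rect)
    (hsub : A ⊆ {p : Rect | ρ ≤ h p}) (hsup : {p : Rect | ρ < h p} ⊆ A) {x : ℝ}
    (hx : x ∈ Icc (-1 : ℝ) 1) (h0 : fm x ≤ 0) : h (x, fm x) = ρ := by
  have hm := e.lower.mapsTo hx
  refine eq_of_vertical_boundary hcont hsub hsup hx ⟨by linarith [hm.2], by linarith [hm.1]⟩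
    (σ := -1) ⟨le_rfl, by norm_num⟩ ?_ ?_
  · rintro ⟨p, hp⟩ rfl
    exact e.mem_iff.2 ⟨le_rfl, h0.trans ((e.nonpos_iff hx).1 h0)⟩
  · rintro ⟨p, hp⟩ s hs rfl hpA
    have h1 : fm x ≤ fm x + s * -1 := (e.mem_iff.1 hpA).1
    linarith [hs.1]

end LevelLines

/-! ### The saddle point -/

section Saddle

variable {h : ℝ × ℝ → ℝ} {ρs K : ℝ}

/-- The density takes the value `ρs` at the saddle point. -/
theorem saddle_value (hcont : ContinuousOn h Rect) (hnonneg : ∀ p ∈ Rect, 0 ≤ h p)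
    (hK : K ∈ Ioo 0 1) (hρs : 0 ≤ ρs)
    (hsaddle : ∀ x y : ℝ, (x, y) ∈ posSet h → x ∈ Icc (-0.2) 0.2 → y ∈ Ioo (-1.1) 1.1 →
      |h (x, y) - ρs - x ^ 2 + y ^ 2| ≤ K * (x ^ 2 + y ^ 2))
    (h2 : ρs ≤ h (0.2, 0)) : h (0, 0) = ρs := by
  have hR : ∀ x ∈ Icc (0 : ℝ) 0.2, (x, (0 : ℝ)) ∈ Rect := fun x hx =>
    ⟨⟨by linarith [hx.1], by linarith [hx.2]⟩, by norm_num, by norm_num⟩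
  have hs : ∀ x ∈ Icc (0 : ℝ) 0.2, 0 < h (x, 0) → |h (x, 0) - ρs - x ^ 2| ≤ K * x ^ 2 := by
    intro x hx hpos
    have := hsaddle x 0 ⟨hR x hx, hpos⟩ ⟨by linarith [hx.1], hx.2⟩ ⟨by norm_num, by norm_num⟩
    simpa using this
  have h0 : (0 : ℝ) ∈ Icc (0 : ℝ) 0.2 := ⟨le_rfl, by norm_num⟩
  -- The saddle estimate is available only where `h > 0`. If `h` vanished at the origin with `ρs >
  -- 0`, it would take the value `ρs / 2` on the axis, where the estimate forces `h ≥ ρs`.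
  rcases (hnonneg _ (hR 0 h0)).eq_or_lt with hz | hpos
  · rw [← hz]
    by_contra hne
    have hρ : 0 < ρs := lt_of_le_of_ne hρs hne
    have hc : ContinuousOn (fun x : ℝ => h (x, 0)) (Icc 0 0.2) := hcont.comp (by fun_prop) hR
    obtain ⟨x, hx, hxv⟩ := intermediate_value_Icc (show (0 : ℝ) ≤ 0.2 by norm_num) hc
      (show ρs / 2 ∈ Icc (h (0, 0)) (h (0.2, 0)) from ⟨by rw [← hz]; linarith, by linarith⟩)
    simp only at hxv
    have := hs x hx (by rw [hxv]; linarith)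
    rw [hxv, abs_le] at this
    nlinarith [hK.2, sq_nonneg x]
  · have := hs 0 h0 hpos
    simp only [ne_eq, OfNat.ofNat_ne_zero, not_false_eq_true, zero_pow, sub_zero, mul_zero] at this
    linarith [abs_nonpos_iff.1 this]

/-- At levels not above the saddle level, the two lobes are connected. -/
theorem Envelope.nonneg_zero_of_le {A : Set Rect} {ρ : ℝ} {fm fp : ℝ → ℝ} {am bm ap bp : ℝ}
    (e : Envelope A fm fp am bm ap bp) (hcont : ContinuousOn h Rect) (hK : K ∈ Ioo 0 1)
    (hsaddle : ∀ x y : ℝ, (x, y) ∈ posSet h → x ∈ Icc (-0.2) 0.2 → y ∈ Ioo (-1.1) 1.1 →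
      |h (x, y) - ρs - x ^ 2 + y ^ 2| ≤ K * (x ^ 2 + y ^ 2))
    (h00 : h (0, 0) = ρs) (hsup : {p : Rect | ρ < h p} ⊆ A) (hρ : 0 < ρ) (hρs : ρ ≤ ρs) :
    0 ≤ fp 0 := by
  by_contra hneg
  rw [not_le] at hneg
  have hR : ∀ x ∈ Icc (0 : ℝ) 0.2, (x, (0 : ℝ)) ∈ Rect := fun x hx =>
    ⟨⟨by linarith [hx.1], by linarith [hx.2]⟩, by norm_num, by norm_num⟩
  have h0 : (0 : ℝ) ∈ Icc (0 : ℝ) 0.2 := ⟨le_rfl, by norm_num⟩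
  have hc : ContinuousOn (fun x : ℝ => h (x, 0)) (Icc 0 0.2) := hcont.comp (by fun_prop) hR
  have hcf : ContinuousOn fp (Icc 0 0.2) :=
    e.upper.continuousOn.mono (Icc_subset_Icc (by norm_num) (by norm_num))
  have : (𝓝[Ioc (0 : ℝ) 0.2] 0).NeBot := by
    rw [← mem_closure_iff_nhdsWithin_neBot, closure_Ioc (by norm_num)]
    exact h0
  have hle : 𝓝[Ioc (0 : ℝ) 0.2] 0 ≤ 𝓝[Icc (0 : ℝ) 0.2] 0 := nhdsWithin_mono _ Ioc_subset_Icc_self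
  have ev1 := ((hc 0 h0).mono_left hle).eventually
    (lt_mem_nhds (show 0 < h (0, 0) by rw [h00]; linarith))
  have ev2 := ((hcf 0 h0).mono_left hle).eventually (gt_mem_nhds hneg)
  -- The point must differ from the origin: for `x ≠ 0` the estimate gives `h (x, 0) > ρs ≥ ρ`
  -- strictly, which puts it in `A`.
  obtain ⟨x, ⟨hpos, hfx⟩, hx⟩ := ((ev1.and ev2).and eventually_mem_nhdsWithin).exists
  have hxR := hR x (Ioc_subset_Icc_self hx)
  have hs := hsaddle x 0 ⟨hxR, hpos⟩ ⟨by linarith [hx.1], hx.2⟩ ⟨by norm_num, by norm_num⟩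
  have hx2 : 0 < x ^ 2 := pow_pos hx.1 2
  rw [abs_le] at hs
  have hlt : ρ < h (x, 0) := by nlinarith [hK.2]
  have hmem : (⟨(x, 0), hxR⟩ : Rect) ∈ A := hsup hlt
  linarith [show 0 ≤ fp x from e.nonneg_of_mem hmem]

end Saddle

/-! ### From gradient bounds to slope bounds -/

section Slopes

theorem fderiv_eq_partials {h : ℝ × ℝ → ℝ} {p : ℝ × ℝ} (hh : DifferentiableAt ℝ h p)
    (v : ℝ × ℝ) : fderiv ℝ h p v = partialX h p * v.1 + partialY h p * v.2 := by
  have hX : partialX h p = fderiv ℝ h p (1, 0) := by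
    have h1 : HasDerivAt (fun s : ℝ => (s, p.2)) ((1 : ℝ), (0 : ℝ)) p.1 :=
      (hasDerivAt_id _).prodMk (hasDerivAt_const _ _)
    exact (hh.hasFDerivAt.comp_hasDerivAt p.1 h1).deriv
  have hY : partialY h p = fderiv ℝ h p (0, 1) := by
    have h1 : HasDerivAt (fun s : ℝ => (p.1, s)) ((0 : ℝ), (1 : ℝ)) p.2 :=
      (hasDerivAt_const _ _).prodMk (hasDerivAt_id _)
    exact (hh.hasFDerivAt.comp_hasDerivAt p.2 h1).deriv
  have hv : v = v.1 • ((1 : ℝ), (0 : ℝ)) + v.2 • ((0 : ℝ), (1 : ℝ)) := by ext <;> simp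
  conv_lhs => rw [hv]
  rw [map_add, map_smul, map_smul, hX, hY, smul_eq_mul, smul_eq_mul]
  ring

theorem eventually_abs_snd_le {h : ℝ × ℝ → ℝ} {φ : ℝ → ℝ × ℝ} {t C η r : ℝ}
    (hh : DifferentiableAt ℝ h (φ t)) (hφ : ContinuousAt φ t) (hη : 0 < η) (hC : 0 < C)
    (hconst : ∀ᶠ s in 𝓝 t, h (φ s) = r) (hb : partialY h (φ t) ≠ 0)
    (hab : |partialX h (φ t)| ≤ C * |partialY h (φ t)|) :
    ∀ᶠ s in 𝓝 t, |(φ s).2 - (φ t).2| ≤ (C + η) * |(φ s).1 - (φ t).1| :=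
  eventually_abs_le_of_const hh hφ hη hC hconst (.fst ℝ ℝ ℝ) (.snd ℝ ℝ ℝ) _ _ hb hab
    (fderiv_eq_partials hh) fun _ => le_rfl

theorem eventually_abs_fst_le {h : ℝ × ℝ → ℝ} {φ : ℝ → ℝ × ℝ} {t C η r : ℝ}
    (hh : DifferentiableAt ℝ h (φ t)) (hφ : ContinuousAt φ t) (hη : 0 < η) (hC : 0 < C)
    (hconst : ∀ᶠ s in 𝓝 t, h (φ s) = r) (hb : partialX h (φ t) ≠ 0)
    (hab : |partialY h (φ t)| ≤ C * |partialX h (φ t)|) :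
    ∀ᶠ s in 𝓝 t, |(φ s).1 - (φ t).1| ≤ (C + η) * |(φ s).2 - (φ t).2| :=
  eventually_abs_le_of_const hh hφ hη hC hconst (.snd ℝ ℝ ℝ) (.fst ℝ ℝ ℝ) _ _ hb hab
    (fun v => by rw [fderiv_eq_partials hh]; exact add_comm _ _) fun v => (max_comm _ _).le

/-- `posSet h` contains edge points of the rectangle and need not be open; at interior points
continuity makes it a neighbourhood. -/
theorem differentiableAt_of_mem_inter_posSet {h : ℝ × ℝ → ℝ} (hcont : ContinuousOn h Rect)
    {U : Set (ℝ × ℝ)} (hU : IsOpen U) (hd : ContDiffOn ℝ 1 h (posSet h ∩ U)) {p : ℝ × ℝ}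
    (hp : p ∈ posSet h ∩ U) (hp1 : p.1 ∈ Ioo (-1 : ℝ) 1) (hp2 : p.2 ∈ Ioo (-2 : ℝ) 2) :
    DifferentiableAt ℝ h p := by
  have hR : Rect ∈ 𝓝 p :=
    mem_of_superset ((isOpen_Ioo.prod isOpen_Ioo).mem_nhds ⟨hp1, hp2⟩)
      (prod_mono Ioo_subset_Icc_self Ioo_subset_Icc_self)
  have hpos : ∀ᶠ q in 𝓝 p, 0 < h q :=
    (hcont.continuousAt hR).eventually (lt_mem_nhds hp.1.2)
  have hmem : posSet h ∩ U ∈ 𝓝 p := by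
    filter_upwards [hR, hpos, hU.mem_nhds hp.2] with q h1 h2 h3
    exact ⟨⟨h1, h2⟩, h3⟩
  exact (hd.contDiffAt hmem).differentiableAt one_ne_zero

/-- A locally steep increasing function is globally steep. -/
theorem sub_le_of_eventually_steep {g : ℝ → ℝ} {x y C : ℝ} (hxy : x ≤ y)
    (hg : ContinuousOn g (Icc x y)) (hm : MonotoneOn g (Icc x y))
    (hloc : ∀ η > 0, ∀ t ∈ Ioo x y, ∀ᶠ s in 𝓝 t, |s - t| ≤ (C + η) * |g s - g t|) :
    y - x ≤ C * (g y - g x) := by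
  have key : ∀ η > 0, y - x ≤ (C + η) * (g y - g x) := by
    intro η hη
    have := le_of_forall_eventually_le (F := fun t => (C + η) * g t - t) hxy
      ((continuousOn_const.mul hg).sub continuousOn_id) ?_
    · linarith
    · intro t ht
      have h1 : ∀ᶠ s in 𝓝[>] t, s ∈ Ioo t y := Ioo_mem_nhdsGT ht.2
      filter_upwards [h1, nhdsWithin_le_nhds (hloc η hη t ht)] with s hs hs'
      have hgs := hm ⟨ht.1.le, ht.2.le⟩ ⟨(ht.1.trans hs.1).le, hs.2.le⟩ hs.1.le
      rw [abs_of_nonneg (by linarith [hs.1]), abs_of_nonneg (by linarith)] at hs'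
      linarith
  -- The local estimate costs an arbitrary `η > 0`, removed by letting `η → 0`.
  have hlim : Tendsto (fun η : ℝ => (C + η) * (g y - g x)) (𝓝[>] 0)
      (𝓝 ((C + 0) * (g y - g x))) :=
    ((tendsto_const_nhds.add tendsto_id).mul tendsto_const_nhds).mono_left nhdsWithin_le_nhds
  rw [add_zero] at hlim
  exact ge_of_tendsto hlim (eventually_mem_nhdsWithin.mono key)

/-- A locally Lipschitz function with a uniform constant is globally Lipschitz. -/
theorem abs_sub_le_of_eventually_lipschitz {g : ℝ → ℝ} {x y C : ℝ} (hxy : x ≤ y)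
    (hg : ContinuousOn g (Icc x y))
    (hloc : ∀ η > 0, ∀ t ∈ Ioo x y, ∀ᶠ s in 𝓝 t, |g s - g t| ≤ (C + η) * |s - t|) :
    |g x - g y| ≤ C * (y - x) := by
  have key : ∀ η > 0, |g x - g y| ≤ (C + η) * (y - x) := by
    intro η hη
    have hl : ∀ t ∈ Ioo x y, ∀ᶠ s in 𝓝[>] t, |g s - g t| ≤ (C + η) * (s - t) := by
      intro t ht
      filter_upwards [eventually_mem_nhdsWithin, nhdsWithin_le_nhds (hloc η hη t ht)] with s hs hs'
      rwa [abs_of_nonneg (sub_nonneg.2 (mem_Ioi.1 hs).le)] at hs'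
    have hlin : ContinuousOn (fun t : ℝ => (C + η) * t) (Icc x y) := by fun_prop
    have h1 := le_of_forall_eventually_le (F := fun t => (C + η) * t - g t) hxy (hlin.sub hg)
      fun t ht => (hl t ht).mono fun s hs => by linarith [(abs_le.1 hs).2]
    have h2 := le_of_forall_eventually_le (F := fun t => (C + η) * t + g t) hxy (hlin.add hg)
      fun t ht => (hl t ht).mono fun s hs => by linarith [(abs_le.1 hs).1]
    rw [abs_le]
    constructor <;> linarith
  have hlim : Tendsto (fun η : ℝ => (C + η) * (y - x)) (𝓝[>] 0) (𝓝 ((C + 0) * (y - x))) :=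
    ((tendsto_const_nhds.add tendsto_id).mul tendsto_const_nhds).mono_left nhdsWithin_le_nhds
  rw [add_zero] at hlim
  exact ge_of_tendsto hlim (eventually_mem_nhdsWithin.mono key)

end Slopes

/-! ### Level lines form lobes -/

theorem sign_mul_mem_union {σ t u v : ℝ} (hσ : σ = 1 ∨ σ = -1) (ht : t ∈ Ioo u v) :
    σ * t ∈ Ioo (-v) (-u) ∪ Ioo u v := by
  rcases hσ with rfl | rfl
  · right; simpa using ht
  · left; rw [neg_one_mul]; exact ⟨neg_lt_neg ht.2, neg_lt_neg ht.1⟩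

theorem sign_mul_mem_Icc {σ t u : ℝ} (hσ : σ = 1 ∨ σ = -1) (ht : t ∈ Icc (-u) u) :
    σ * t ∈ Icc (-u) u := by
  rcases hσ with rfl | rfl
  · simpa using ht
  · rw [neg_one_mul]; exact ⟨neg_le_neg ht.2, by linarith [ht.1]⟩

theorem sign_mul_mem_Ioo {σ t u : ℝ} (hσ : σ = 1 ∨ σ = -1) (ht : t ∈ Ioo (-u) u) :
    σ * t ∈ Ioo (-u) u := by
  rcases hσ with rfl | rfl
  · simpa using ht
  · rw [neg_one_mul]; exact ⟨neg_lt_neg ht.2, by linarith [ht.1]⟩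

theorem abs_sign {σ : ℝ} (hσ : σ = 1 ∨ σ = -1) : |σ| = 1 := by
  rcases hσ with rfl | rfl <;> simp

theorem sign_sq {σ : ℝ} (hσ : σ = 1 ∨ σ = -1) : σ ^ 2 = 1 := by
  rcases hσ with rfl | rfl <;> simp

theorem abs_sign_mul_sub {σ : ℝ} (hσ : σ = 1 ∨ σ = -1) (s t : ℝ) :
    |σ * s - σ * t| = |s - t| := by
  rw [← mul_sub, abs_mul, abs_sign hσ, one_mul]

/-- An envelope function, up to reflections, whose graph is a level line of the density is a
lobe. -/
theorem isLobe_of_level_line {h : ℝ × ℝ → ℝ} {ρ ρs K C : ℝ} (hcont : ContinuousOn h Rect)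
    (hK : K ∈ Ioo 0 1) (hC : 0 < C)
    (hsaddle : ∀ x y : ℝ, (x, y) ∈ posSet h → x ∈ Icc (-0.2) 0.2 → y ∈ Ioo (-1.1) 1.1 →
      |h (x, y) - ρs - x ^ 2 + y ^ 2| ≤ K * (x ^ 2 + y ^ 2))
    (hdiff₁ : ContDiffOn ℝ 1 h (region₁ h))
    (hdiff₂ : ContDiffOn ℝ 1 h (region₂ h))
    (hdiff₃ : ContDiffOn ℝ 1 h (region₃ h K))
    (hy : ∀ p ∈ region₁ h, partialY h p ≠ 0)
    (hx : ∀ p ∈ region₂ h ∪ region₃ h K, partialX h p ≠ 0)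
    (hxy : ∀ p ∈ region₁ h, |partialX h p| ≤ C * |partialY h p|)
    (hyx : ∀ p ∈ region₂ h ∪ region₃ h K, |partialY h p| ≤ C * |partialX h p|)
    (hρ : 0 < ρ) {σ τ : ℝ} (hσ : σ = 1 ∨ σ = -1) (hτ : τ = 1 ∨ τ = -1) {g : ℝ → ℝ} {a b : ℝ}
    (hg : IsTwoPeaked g a b) (hbulk : ∀ t ∈ Icc (0.2 : ℝ) 0.8, 0.2 ≤ g t)
    (hline : ∀ t ∈ Icc (-1 : ℝ) 1, 0 ≤ g t → h (σ * t, τ * g t) = ρ) :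
    IsLobe g b (max C √((1 + K) / (1 - K))) := by
  have hb := hg.right_mem
  set κ : ℝ := √((1 + K) / (1 - K)) with hκ
  have hK1 : 0 < 1 - K := by linarith [hK.2]
  have hκ2 : (1 - K) * κ ^ 2 = 1 + K := by
    rw [hκ, Real.sq_sqrt (div_nonneg (by linarith [hK.1]) hK1.le)]
    field_simp
  have hκ0 : 0 ≤ κ := Real.sqrt_nonneg _
  have hIoo : ∀ {t : ℝ}, t ∈ Ioo (-1 : ℝ) 1 → t ∈ Icc (-1 : ℝ) 1 :=
    fun ht => Ioo_subset_Icc_self ht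
  set φ : ℝ → ℝ × ℝ := fun t => (σ * t, τ * g t) with hφdef
  have hgc : ∀ t ∈ Ioo (-1 : ℝ) 1, ContinuousAt g t := fun t ht =>
    hg.continuousOn.continuousAt (Icc_mem_nhds ht.1 ht.2)
  have hφ : ∀ t ∈ Ioo (-1 : ℝ) 1, ContinuousAt φ t := fun t ht =>
    (continuousAt_const.mul continuousAt_id).prodMk (continuousAt_const.mul (hgc t ht))
  have hconst : ∀ t ∈ Ioo (-1 : ℝ) 1, 0 < g t → ∀ᶠ s in 𝓝 t, h (φ s) = ρ := by
    intro t ht h0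
    filter_upwards [(hgc t ht).eventually (lt_mem_nhds h0), Icc_mem_nhds ht.1 ht.2] with s h1 h2
    exact hline s h2 h1.le
  have hg1 : ∀ t ∈ Icc (-1 : ℝ) 1, 0 ≤ g t → τ * g t ∈ Icc (-1 : ℝ) 1 := fun t ht h0 =>
    sign_mul_mem_Icc hτ (hg.mapsTo ht)
  have hpos : ∀ t ∈ Icc (-1 : ℝ) 1, 0 ≤ g t → φ t ∈ posSet h := by
    intro t ht h0
    have h1 := hg1 t ht h0
    refine ⟨⟨sign_mul_mem_Icc hσ ht, ?_, ?_⟩, by rw [hline t ht h0]; exact hρ⟩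
    · change -2 ≤ τ * g t
      linarith [h1.1]
    · change τ * g t ≤ 2
      linarith [h1.2]
  have hin1 : ∀ t ∈ Ioo (-1 : ℝ) 1, (φ t).1 ∈ Ioo (-1 : ℝ) 1 := fun t ht =>
    sign_mul_mem_Ioo hσ ht
  have hin2 : ∀ t ∈ Icc (-1 : ℝ) 1, 0 ≤ g t → (φ t).2 ∈ Ioo (-2 : ℝ) 2 := fun t ht h0 => by
    have h1 := hg1 t ht h0
    change τ * g t ∈ _
    exact ⟨by linarith [h1.1], by linarith [h1.2]⟩
  have hsad : ∀ t, 0 ≤ t → t ≤ 0.2 → 0 ≤ g t →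
      |ρ - ρs - t ^ 2 + g t ^ 2| ≤ K * (t ^ 2 + g t ^ 2) := by
    intro t ht0 ht2 h0
    have htI : t ∈ Icc (-1 : ℝ) 1 := ⟨by linarith, by linarith⟩
    have h1 := hg1 t htI h0
    have := hsaddle (σ * t) (τ * g t) (hpos t htI h0)
      (sign_mul_mem_Icc hσ ⟨by linarith, ht2⟩) ⟨by linarith [h1.1], by linarith [h1.2]⟩
    rwa [hline t htI h0, mul_pow, mul_pow, sign_sq hσ, sign_sq hτ, one_mul, one_mul] at this
  have hflat : ∀ η > 0, ∀ t ∈ Ioo (0.3 : ℝ) 0.7,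
      ∀ᶠ s in 𝓝 t, |g s - g t| ≤ (C + η) * |s - t| := by
    intro η hη t ht
    have htI : t ∈ Ioo (-1 : ℝ) 1 := ⟨by linarith [ht.1], by linarith [ht.2]⟩
    -- The inequality must be strict because `region₁` excludes height `0.2`; strict monotonicity
    -- away from `0.2` and `0.8` provides it.
    have h02 : 0.2 < g t := by
      rcases le_total t b with htb | htb
      · exact (hbulk 0.2 ⟨le_rfl, by norm_num⟩).trans_lt (hg.strictMonoOn_right
          ⟨by norm_num, by linarith [hb.1]⟩ ⟨by linarith [ht.1], htb⟩ (by linarith [ht.1]))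
      · exact (hbulk 0.8 ⟨by norm_num, le_rfl⟩).trans_lt (hg.strictAntiOn_right
          ⟨htb, by linarith [ht.2]⟩ ⟨by linarith [hb.2], by norm_num⟩ (by linarith [ht.2]))
    have h0 : 0 < g t := by linarith
    have hmem : φ t ∈ region₁ h := ⟨hpos t (hIoo htI) h0.le, sign_mul_mem_union hσ ht,
      sign_mul_mem_union hτ ⟨h02, by linarith [(hg.mapsTo (hIoo htI)).2]⟩⟩
    have hd := differentiableAt_of_mem_inter_posSet hcont
      ((isOpen_Ioo.union isOpen_Ioo).prod (isOpen_Ioo.union isOpen_Ioo)) hdiff₁ hmem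
      (hin1 t htI) (hin2 t (hIoo htI) h0.le)
    filter_upwards [eventually_abs_snd_le hd (hφ t htI) hη hC (hconst t htI h0) (hy _ hmem)
      (hxy _ hmem)] with s hs
    simpa only [hφdef, abs_sign_mul_sub hσ, abs_sign_mul_sub hτ] using hs
  have hlip : ∀ x ∈ Icc (0.3 : ℝ) 0.7, ∀ y ∈ Icc (0.3 : ℝ) 0.7, x ≤ y →
      |g x - g y| ≤ max C κ * |x - y| := by
    intro x hxI y hyI hle
    have h1 := abs_sub_le_of_eventually_lipschitz hle
      (hg.continuousOn.mono (Icc_subset_Icc (by linarith [hxI.1]) (by linarith [hyI.2])))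
      (fun η hη t ht => hflat η hη t ⟨hxI.1.trans_lt ht.1, ht.2.trans_le hyI.2⟩)
    rw [abs_sub_comm x y, abs_of_nonneg (sub_nonneg.2 hle)]
    exact h1.trans (mul_le_mul_of_nonneg_right (le_max_left _ _) (sub_nonneg.2 hle))
  have hsteep : ∀ η > 0, ∀ t ∈ Ioo (-1 : ℝ) 1, 0 < g t → φ t ∈ region₂ h ∪ region₃ h K →
      ∀ᶠ s in 𝓝 t, |s - t| ≤ (C + η) * |g s - g t| := by
    intro η hη t htI h0 hmem
    have hd : DifferentiableAt ℝ h (φ t) := by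
      rcases hmem with hmem | hmem
      · exact differentiableAt_of_mem_inter_posSet hcont
          ((isOpen_Ioo.union isOpen_Ioo).prod (isOpen_Ioo.union isOpen_Ioo)) hdiff₂ hmem
          (hin1 t htI) (hin2 t (hIoo htI) h0.le)
      · refine differentiableAt_of_mem_inter_posSet hcont (IsOpen.inter
          ((isOpen_Ioo.union isOpen_Ioo).preimage continuous_fst) ?_) hdiff₃ hmem
          (hin1 t htI) (hin2 t (hIoo htI) h0.le)
        exact isOpen_lt continuous_snd.abs (continuous_const.mul continuous_fst.abs)
    filter_upwards [eventually_abs_fst_le hd (hφ t htI) hη hC (hconst t htI h0) (hx _ hmem)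
      (hyx _ hmem)] with s hs
    simpa only [hφdef, abs_sign_mul_sub hσ, abs_sign_mul_sub hτ] using hs
  refine ⟨hb, hg.strictMonoOn_right.monotoneOn, hg.strictAntiOn_right.antitoneOn, hbulk,
    ?_, ?_, ?_⟩
  · intro x hxI y hyI
    rcases le_total x y with hle | hle
    · exact hlip x hxI y hyI hle
    · rw [abs_sub_comm, abs_sub_comm x y]
      exact hlip y hyI x hxI hle
  · intro x y hx0 hle hy2 hgx
    have hm : StrictMonoOn g (Icc x y) :=
      hg.strictMonoOn_right.mono (Icc_subset_Icc hx0 (by linarith [hb.1]))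
    have hgy : 0 ≤ g y := hgx.trans (hm.monotoneOn ⟨le_rfl, hle⟩ ⟨hle, le_rfl⟩ hle)
    rcases le_or_gt ρ ρs with hlow | hhigh
    -- For `ρ ≤ ρs` the lower saddle bound gives `(1 - K) * y ^ 2 ≤ (1 + K) * g y ^ 2`, so no
    -- derivative is needed.
    · have hs := (abs_le.1 (hsad y (hx0.trans hle) hy2 hgy)).1
      have hsq : y ^ 2 ≤ (κ * g y) ^ 2 := by
        have : (1 - K) * y ^ 2 ≤ (1 - K) * (κ * g y) ^ 2 := by
          rw [mul_pow, ← mul_assoc, hκ2]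
          linarith
        exact le_of_mul_le_mul_left this hK1
      have h1 : y ≤ κ * g y :=
        (pow_le_pow_iff_left₀ (hx0.trans hle) (by positivity) two_ne_zero).1 hsq
      have h2 : κ * g y ≤ max C κ * g y := mul_le_mul_of_nonneg_right (le_max_right _ _) hgy
      linarith
    · have h1 := sub_le_of_eventually_steep (C := C) hle
        (hg.continuousOn.mono (Icc_subset_Icc (by linarith) (by linarith))) hm.monotoneOn ?_
      · have h2 : C * g y ≤ max C κ * g y := mul_le_mul_of_nonneg_right (le_max_left _ _) hgy
        nlinarith
      · intro η hη t ht
        have htI : t ∈ Ioo (-1 : ℝ) 1 := ⟨by linarith [ht.1], by linarith [ht.2]⟩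
        have ht0 : 0 < t := hx0.trans_lt ht.1
        have ht2 : t < 0.2 := ht.2.trans_le hy2
        have hgt : 0 < g t := hgx.trans_lt (hm ⟨le_rfl, hle⟩ ⟨ht.1.le, ht.2.le⟩ ht.1)
        refine hsteep η hη t htI hgt (Or.inr ⟨hpos t (hIoo htI) hgt.le, ?_, ?_⟩)
        · simpa using sign_mul_mem_union hσ (show t ∈ Ioo 0 0.2 from ⟨ht0, ht2⟩)
        · change |τ * g t| < κ * |σ * t|
          rw [abs_mul, abs_mul, abs_sign hτ, abs_sign hσ, one_mul, one_mul, abs_of_pos hgt,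
            abs_of_pos ht0]
          -- For `ρ > ρs` the upper saddle bound gives `(1 - K) * g t ^ 2 < (1 + K) * t ^ 2`: the
          -- graph stays inside the cone of `region₃`.
          have hs := (abs_le.1 (hsad t ht0.le ht2.le hgt.le)).2
          have hsq : g t ^ 2 < (κ * t) ^ 2 := by
            have : (1 - K) * g t ^ 2 < (1 - K) * (κ * t) ^ 2 := by
              rw [mul_pow, ← mul_assoc, hκ2]
              linarith
            exact lt_of_mul_lt_mul_left this hK1.le
          exact (pow_lt_pow_iff_left₀ hgt.le (by positivity) two_ne_zero).1 hsq
  · intro x y hy8 hle hx1 hgx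
    have hm : StrictAntiOn g (Icc y x) :=
      hg.strictAntiOn_right.mono (Icc_subset_Icc (by linarith [hb.2]) hx1)
    have hgy : 0 ≤ g y := hgx.trans (hm.antitoneOn ⟨le_rfl, hle⟩ ⟨hle, le_rfl⟩ hle)
    have hc : ContinuousOn (fun t => g (-t)) (Icc (-x) (-y)) :=
      hg.continuousOn.comp continuousOn_neg
        fun t ht => ⟨by linarith [ht.1, ht.2], by linarith [ht.1, ht.2]⟩
    have hmono : MonotoneOn (fun t => g (-t)) (Icc (-x) (-y)) := fun s hs t ht hst =>
      hm.antitoneOn ⟨by linarith [ht.2], by linarith [ht.1]⟩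
        ⟨by linarith [hs.2], by linarith [hs.1]⟩ (neg_le_neg hst)
    have h1 := sub_le_of_eventually_steep (C := C) (neg_le_neg hle) hc hmono ?_
    · have h2 : C * g y ≤ max C κ * g y := mul_le_mul_of_nonneg_right (le_max_left _ _) hgy
      simp only [neg_neg] at h1
      nlinarith
    · intro η hη t ht
      have ht' : -t ∈ Ioo y x := ⟨by linarith [ht.2], by linarith [ht.1]⟩
      have htI : -t ∈ Ioo (-1 : ℝ) 1 := ⟨by linarith [ht'.1], by linarith [ht'.2]⟩
      have hgt : 0 < g (-t) := hgx.trans_lt (hm ⟨ht'.1.le, ht'.2.le⟩ ⟨hle, le_rfl⟩ ht'.2)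
      have hmem : φ (-t) ∈ region₂ h ∪ region₃ h K := by
        refine Or.inl ⟨hpos _ (hIoo htI) hgt.le,
          sign_mul_mem_union hσ ⟨by linarith [ht'.1], by linarith [ht'.2]⟩, ?_⟩
        have := sign_mul_mem_union hτ (show g (-t) ∈ Ioo 0 1.1 from
          ⟨hgt, by linarith [(hg.mapsTo (hIoo htI)).2]⟩)
        simpa using this
      filter_upwards [(continuous_neg.tendsto t).eventually (hsteep η hη _ htI hgt hmem)]
        with s hs
      rwa [show -s - -t = -(s - t) by ring, abs_neg] at hs

/-! ### Thickness of enveloped sets -/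

namespace Envelope

variable {A : Set Rect} {fm fp : ℝ → ℝ} {am bm ap bp : ℝ}

/-- Every point of one half of an enveloped set is close to the center of a square inside of the
set. -/
theorem exists_center_of_isLobe (e : Envelope A fm fp am bm ap bp) {σ c b₁ b₂ : ℝ}
    (hσ : σ = 1 ∨ σ = -1) (hc : 1 ≤ c) (h₁ : IsLobe (fun t => fp (σ * t)) b₁ c)
    (h₂ : IsLobe (fun t => -fm (σ * t)) b₂ c) :
    ∃ δ₀ > (0.1 : ℝ), ∀ δ ∈ Ioo 0 δ₀, ∀ p ∈ A, 0 ≤ σ * p.1.1 →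
      ∃ q : Rect, dist p q ≤ (1 + c) * δ ∧ ∀ r : Rect, dist r q ≤ δ → r ∈ A := by
  obtain ⟨δ₀, hδ₀, H⟩ := h₁.exists_isWindow h₂ hc
  refine ⟨δ₀, hδ₀, fun δ hδ p hp hp0 => ?_⟩
  have hσσ : ∀ x, σ * (σ * x) = x := fun x => by rw [← mul_assoc, ← sq, sign_sq hσ, one_mul]
  have hδ0 := hδ.1
  have hcδ : 0 < c * δ := by have := hδ.1; positivity
  have hfp := e.nonneg_of_mem hp
  have hfm := (e.nonpos_iff p.2.1).2 hfp
  obtain ⟨z, hz, hw₁, hw₂⟩ := H δ hδ (σ * p.1.1)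
    ⟨hp0, (sign_mul_mem_Icc hσ p.2.1).2⟩ (by simpa only [hσσ] using hfp)
    (by simp only [hσσ]; linarith)
  simp only [IsWindow, hσσ] at hw₁ hw₂
  set U := max δ (fp p.1.1 - c * δ) with hU
  set V := max δ (-fm p.1.1 - c * δ) with hV
  have hUw : ∀ s, |s - z| ≤ δ → U ≤ fp (σ * s) := fun s hs => max_le (hw₁ s hs).2.1 (hw₁ s hs).2.2
  have hVw : ∀ s, |s - z| ≤ δ → V ≤ -fm (σ * s) := fun s hs =>
    max_le (hw₂ s hs).2.1 (hw₂ s hs).2.2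
  have hzz : |z - z| ≤ δ := by rw [sub_self, abs_zero]; exact hδ.1.le
  have hzI := (hw₁ z hzz).1
  have hσz : σ * z ∈ Icc (-1 : ℝ) 1 := sign_mul_mem_Icc hσ ⟨by linarith [hzI.1], hzI.2⟩
  have hU1 := (hUw z hzz).trans (e.upper.mapsTo hσz).2
  have hV1 := (hVw z hzz).trans (e.lower.mapsTo hσz).2
  have hUδ : δ ≤ U := le_max_left _ _
  have hVδ : δ ≤ V := le_max_left _ _
  have hUp : fp p.1.1 - c * δ ≤ U := le_max_right _ _
  have hVp : -fm p.1.1 - c * δ ≤ V := le_max_right _ _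
  -- Over the window the set contains all heights in `[-V, U]`; the ordinate of `p` is clamped to
  -- `[-(V - δ), U - δ]`, nonempty because `U` and `V` are at least `δ`.
  set y := max (-(V - δ)) (min p.1.2 (U - δ)) with hy
  have hy1 : -(V - δ) ≤ y := le_max_left _ _
  have hy2 : y ≤ U - δ := max_le (by linarith) (min_le_right _ _)
  obtain ⟨hp1, hp2⟩ := e.mem_iff.1 hp
  have hyp1 : y ≤ p.1.2 + (1 + c) * δ :=
    max_le (by linarith) ((min_le_left _ _).trans (by nlinarith))
  have hyp2 : p.1.2 - (1 + c) * δ ≤ y :=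
    le_trans (le_min (by nlinarith) (by linarith)) (le_max_right _ _)
  have hqR : (σ * z, y) ∈ Rect := ⟨hσz, by change -2 ≤ y; linarith, by change y ≤ 2; linarith⟩
  refine ⟨⟨(σ * z, y), hqR⟩, ?_, ?_⟩
  · rw [Subtype.dist_eq, Prod.dist_eq]
    refine max_le ?_ ?_
    · change |p.1.1 - σ * z| ≤ _
      have := abs_sign_mul_sub hσ (σ * p.1.1) z
      rw [hσσ] at this
      rwa [this, abs_sub_comm]
    · change |p.1.2 - y| ≤ _
      rw [abs_le]
      constructor <;> linarith
  · intro r hr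
    rw [Subtype.dist_eq, Prod.dist_eq] at hr
    have hr1 : |r.1.1 - σ * z| ≤ δ := (le_max_left _ _).trans hr
    have hr2 : |r.1.2 - y| ≤ δ := (le_max_right _ _).trans hr
    have hs : |σ * r.1.1 - z| ≤ δ := by
      have := abs_sign_mul_sub hσ (σ * r.1.1) z
      rw [hσσ] at this
      rwa [← this]
    have h1 := hUw _ hs
    have h2 := hVw _ hs
    rw [hσσ] at h1 h2
    rw [abs_le] at hr2
    exact e.mem_iff.2 ⟨by linarith, by linarith⟩

theorem psiStar_le (e : Envelope A fm fp am bm ap bp) {c δ : ℝ} (hc : 1 ≤ c)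
    (hlobes : ∀ σ : ℝ, σ = 1 ∨ σ = -1 → ∃ b₁ b₂, IsLobe (fun t => fp (σ * t)) b₁ c ∧
      IsLobe (fun t => -fm (σ * t)) b₂ c) (hδ : δ ∈ Ioc 0 0.1) :
    psiStar A δ ≤ ENNReal.ofReal ((1 + c) * δ) := by
  obtain ⟨_, _, h₁, h₂⟩ := hlobes 1 (Or.inl rfl)
  obtain ⟨_, _, h₃, h₄⟩ := hlobes (-1) (Or.inr rfl)
  obtain ⟨δ₁, hδ₁, H₁⟩ := e.exists_center_of_isLobe (Or.inl rfl) hc h₁ h₂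
  obtain ⟨δ₂, hδ₂, H₂⟩ := e.exists_center_of_isLobe (Or.inr rfl) hc h₃ h₄
  refine iSup₂_le fun p hp => ?_
  -- Membership in `innerTube A δ` requires distance strictly larger than `δ` to the complement.
  -- Squares of half-side `ε > δ` ensure this, and then `ε → δ`; at `δ = 0.1` this uses windows of
  -- radius beyond `0.1`.
  have key : ∀ ε ∈ Ioo δ (min δ₁ δ₂),
      Metric.infEDist p (innerTube A δ) ≤ ENNReal.ofReal ((1 + c) * ε) := by
    rintro ε ⟨hε, hε'⟩
    rw [lt_min_iff] at hε'
    have hε0 : 0 < ε := hδ.1.trans hε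
    obtain ⟨q, hpq, hq⟩ : ∃ q : Rect, dist p q ≤ (1 + c) * ε ∧
        ∀ r : Rect, dist r q ≤ ε → r ∈ A := by
      rcases le_total 0 p.1.1 with h0 | h0
      · exact H₁ ε ⟨hε0, hε'.1⟩ p hp (by linarith)
      · exact H₂ ε ⟨hε0, hε'.2⟩ p hp (by linarith)
    have hmem : q ∈ innerTube A δ := by
      intro hout
      have hle : ENNReal.ofReal ε ≤ Metric.infEDist q Aᶜ := by
        refine Metric.le_infEDist.2 fun r hr => ?_
        rw [edist_dist]
        refine ENNReal.ofReal_le_ofReal ?_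
        by_contra hlt
        rw [not_le, dist_comm] at hlt
        exact hr (hq r hlt.le)
      have hcontra : ENNReal.ofReal ε ≤ ENNReal.ofReal δ := hle.trans hout
      rw [ENNReal.ofReal_le_ofReal_iff hδ.1.le] at hcontra
      linarith
    refine (Metric.infEDist_le_edist_of_mem hmem).trans ?_
    rw [edist_dist]
    exact ENNReal.ofReal_le_ofReal hpq
  have hlt : δ < min δ₁ δ₂ := hδ.2.trans_lt (lt_min hδ₁ hδ₂)
  have hlim : Tendsto (fun ε : ℝ => ENNReal.ofReal ((1 + c) * ε)) (𝓝[>] δ)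
      (𝓝 (ENNReal.ofReal ((1 + c) * δ))) :=
    (ENNReal.continuous_ofReal.comp (continuous_const.mul continuous_id)).continuousAt.mono_left
      nhdsWithin_le_nhds
  exact ge_of_tendsto hlim ((show ∀ᶠ ε in 𝓝[>] δ, ε ∈ Ioo δ (min δ₁ δ₂) from
    Ioo_mem_nhdsGT hlt).mono key)

end Envelope

theorem IsTwoPeaked.exists_comp_sign_mul {f : ℝ → ℝ} {a b σ : ℝ} (hf : IsTwoPeaked f a b)
    (hσ : σ = 1 ∨ σ = -1) : ∃ a' b', IsTwoPeaked (fun t => f (σ * t)) a' b' := by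
  rcases hσ with rfl | rfl
  · exact ⟨a, b, by simpa only [one_mul] using hf⟩
  · exact ⟨-b, -a, by simpa only [neg_one_mul] using hf.reflect⟩

/-- The complement is empty and `d(x, ∅) = ∞`, so even the points on the edge of the space survive
the reduction. -/
theorem psiStar_univ {X : Type*} [PseudoMetricSpace X] (δ : ℝ) : psiStar (univ : Set X) δ = 0 := by
  have : innerTube (univ : Set X) δ = univ := by
    rw [innerTube, outerTube, compl_univ, compl_eq_univ_sdiff]
    ext x
    simp
  simp [psiStar, this, Metric.infEDist_zero_of_mem]

/-- Bounds for the abscissa of a point of the level line near the saddle point. -/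
theorem abscissa_bounds {K ε r : ℝ} (hK : K ∈ Ioo 0 1) (hr : 0 < r)
    (h : |ε - r ^ 2| ≤ K * r ^ 2) : √ε / √(1 + K) ≤ r ∧ r ≤ √ε / √(1 - K) := by
  rw [abs_le] at h
  have h1 : 0 < 1 + K := by linarith [hK.1]
  have h2 : 0 < 1 - K := by linarith [hK.2]
  constructor
  · rw [← Real.sqrt_div' _ h1.le, Real.sqrt_le_left hr.le, div_le_iff₀ h1]
    linarith
  · rw [← Real.sqrt_div' _ h2.le, Real.le_sqrt' hr, le_div_iff₀ h2]
    linarith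

end DensityClustering

/-! ### Assembly of the theorem -/

theorem mainTheorem1
    (h : ℝ × ℝ → ℝ) (hcont : ContinuousOn h Rect) (hnonneg : ∀ p ∈ Rect, 0 ≤ h p)
    (P : Measure Rect) (hprob : IsProbabilityMeasure P)
    (hdens : P = lebesgue.withDensity (fun p => ENNReal.ofReal (h p)))
    (ρs ρss K C : ℝ) (hρss : 0 < ρss) (hρs : ρs ∈ Ico 0 ρss) (hK : K ∈ Ioo 0 1) (hC : 0 < C)
    (hlevel : ∀ ρ ∈ Ioc 0 ρss, IsEnveloped (levelSet lebesgue P ρ))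
    (hsaddle : ∀ x y : ℝ, (x, y) ∈ posSet h → x ∈ Icc (-0.2) 0.2 → y ∈ Ioo (-1.1) 1.1 →
      |h (x, y) - ρs - x ^ 2 + y ^ 2| ≤ K * (x ^ 2 + y ^ 2))
    (hdiff₁ : ContDiffOn ℝ 1 h (region₁ h))
    (hdiff₂ : ContDiffOn ℝ 1 h (region₂ h))
    (hdiff₃ : ContDiffOn ℝ 1 h (region₃ h K))
    (hy : ∀ p ∈ region₁ h, partialY h p ≠ 0)
    (hx : ∀ p ∈ region₂ h ∪ region₃ h K, partialX h p ≠ 0)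
    (hxy : ∀ p ∈ region₁ h, |partialX h p| ≤ C * |partialY h p|)
    (hyx : ∀ p ∈ region₂ h ∪ region₃ h K, |partialY h p| ≤ C * |partialX h p|) :
    HasThickLevels lebesgue P 1 ρss (1 + max C √((1 + K) / (1 - K))) 0.1 ∧
    CanBeClustered lebesgue P ρs ρss ∧
    ∀ ε ∈ Ioc 0 (ρss - ρs),
      ENNReal.ofReal (2 / √(1 + K) * √ε) ≤ tauStar (levelSet lebesgue P (ρs + ε)) ∧
      tauStar (levelSet lebesgue P (ρs + ε)) ≤ ENNReal.ofReal (2 / √(1 - K) * √ε) := by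
  have hsub := levelSet_subset hcont hnonneg hdens
  have hsup := subset_levelSet hcont hnonneg hdens
  have hanti := levelSet_antitone hcont hnonneg hdens
  have hM0 := levelSet_zero hcont hnonneg hdens
  have hnormal := normal hcont hnonneg hdens
  have hac : P ≪ lebesgue := hdens ▸ withDensity_absolutelyContinuous _ _
  have henv : ∀ ρ ∈ Ioc 0 ρss, ∃ fm fp am bm ap bp,
      Envelope (levelSet lebesgue P ρ) fm fp am bm ap bp :=
    fun ρ hρ => (hlevel ρ hρ).exists_envelope
  -- The bulk bound at level `ρss` puts `(0.2, 0)` in the level set, so `h` exceeds `ρs` there, as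
  -- `saddle_value` needs.
  have h00 : h (0, 0) = ρs := by
    obtain ⟨fm, fp, _, _, _, _, e⟩ := henv ρss ⟨hρss, le_rfl⟩
    have h2 := (e.bulk 0.2 (Or.inr ⟨by norm_num, by norm_num⟩)).2
    have hmem := hsub ρss (e.axisPoint_mem (x := 0.2) ⟨by norm_num, by norm_num⟩ (by linarith))
    exact saddle_value hcont hnonneg hK hρs.1 hsaddle (hρs.2.le.trans hmem)
  have hlow : ∀ ρ ∈ Ioc 0 ρss, ∀ fm fp am bm ap bp,
      Envelope (levelSet lebesgue P ρ) fm fp am bm ap bp → (0 ≤ fp 0 ↔ ρ ≤ ρs) := by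
    intro ρ hρ fm fp am bm ap bp e
    constructor
    · intro h0
      have hmem := hsub ρ (e.axisPoint_mem (x := 0) ⟨by norm_num, by norm_num⟩ h0)
      exact h00 ▸ hmem
    · exact e.nonneg_zero_of_le hcont hK hsaddle h00 (hsup ρ) hρ.1
  have hpair : ∀ ρ ∈ Ioc 0 ρss, ρs < ρ →
      components (levelSet lebesgue P ρ) = {levelSet lebesgue P ρ ∩ {p : Rect | p.1.1 ≤ 0},
        levelSet lebesgue P ρ ∩ {p : Rect | 0 ≤ p.1.1}} ∧
      levelSet lebesgue P ρ ∩ {p : Rect | p.1.1 ≤ 0} ≠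
        levelSet lebesgue P ρ ∩ {p : Rect | 0 ≤ p.1.1} := by
    intro ρ hρ hlt
    obtain ⟨fm, fp, _, _, _, _, e⟩ := henv ρ hρ
    have h0 : fp 0 < 0 := not_le.1 fun h0 => absurd ((hlow ρ hρ _ _ _ _ _ _ e).1 h0) hlt.not_ge
    exact ⟨e.components_of_neg h0, e.left_ne_right h0⟩
  have hone : ∀ ρ ∈ Icc 0 ρss, ρ ≤ ρs → (components (levelSet lebesgue P ρ)).encard = 1 := by
    intro ρ hρ hle
    rcases hρ.1.eq_or_lt with rfl | hpos
    -- Level `0` has no envelopes, but its level set is the whole convex rectangle.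
    · have hconv : Convex ℝ Rect := (convex_Icc _ _).prod (convex_Icc _ _)
      have hR : IsPreconnected (univ : Set Rect) :=
        (isPreconnected_iff_preconnectedSpace.1 hconv.isPreconnected).isPreconnected_univ
      rw [hM0, components_of_isPreconnected hR
        ⟨axisPoint 0 ⟨by norm_num, by norm_num⟩, trivial⟩, encard_singleton]
    · obtain ⟨fm, fp, _, _, _, _, e⟩ := henv ρ ⟨hpos, hρ.2⟩
      rw [e.components_of_nonneg ((hlow ρ ⟨hpos, hρ.2⟩ _ _ _ _ _ _ e).2 hle), encard_singleton]
  have htwo : ∀ ρ ∈ Ioc 0 ρss, ρs < ρ → (components (levelSet lebesgue P ρ)).encard = 2 := by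
    intro ρ hρ hlt
    obtain ⟨h1, h2⟩ := hpair ρ hρ hlt
    rw [h1, encard_pair h2]
  have hpos : ∀ {ρ}, ρ ∈ Icc 0 ρss → ρs < ρ → ρ ∈ Ioc 0 ρss := fun hρ hlt =>
    ⟨hρs.1.trans_lt hlt, hρ.2⟩
  have hκ : 1 ≤ √((1 + K) / (1 - K)) := by
    rw [Real.one_le_sqrt, le_div_iff₀ (by linarith [hK.2])]
    linarith [hK.1]
  have hc : 1 ≤ max C √((1 + K) / (1 - K)) := hκ.trans (le_max_right _ _)
  refine ⟨?_, ?_, ?_⟩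
  · refine ⟨⟨zero_lt_one, le_rfl⟩, hρss, by linarith, ⟨by norm_num, by norm_num⟩, hac, hnormal, ?_⟩
    intro δ hδ ρ hρ
    rw [Real.rpow_one]
    rcases hρ.1.eq_or_lt with rfl | hρ0
    · rw [hM0, psiStar_univ]
      exact zero_le
    · obtain ⟨fm, fp, am, bm, ap, bp, e⟩ := henv ρ ⟨hρ0, hρ.2⟩
      refine e.psiStar_le hc (fun σ hσ => ?_) hδ
      obtain ⟨a₁, b₁, hp₁⟩ := e.upper.exists_comp_sign_mul hσ
      obtain ⟨a₂, b₂, hp₂⟩ := e.lower.exists_comp_sign_mul hσ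
      have hbulk : ∀ t ∈ Icc (0.2 : ℝ) 0.8, fm (σ * t) ≤ -0.2 ∧ 0.2 ≤ fp (σ * t) := by
        intro t ht
        refine e.bulk _ ?_
        rcases hσ with rfl | rfl
        · exact Or.inr (by rwa [one_mul])
        · exact Or.inl (by rw [neg_one_mul]; exact ⟨neg_le_neg ht.2, neg_le_neg ht.1⟩)
      refine ⟨b₁, b₂, ?_, ?_⟩
      · refine isLobe_of_level_line hcont hK hC hsaddle hdiff₁ hdiff₂ hdiff₃ hy hx hxy hyx hρ0 hσ
          (τ := 1) (Or.inl rfl) hp₁ (fun t ht => (hbulk t ht).2) fun t ht h0 => ?_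
        rw [one_mul]
        exact e.eq_on_upper hcont (hsub ρ) (hsup ρ) (sign_mul_mem_Icc hσ ht) h0
      · refine isLobe_of_level_line hcont hK hC hsaddle hdiff₁ hdiff₂ hdiff₃ hy hx hxy hyx hρ0 hσ
          (τ := -1) (Or.inr rfl) hp₂ (fun t ht => by linarith [(hbulk t ht).1]) fun t ht h0 => ?_
        rw [neg_one_mul, neg_neg]
        exact e.eq_on_lower hcont (hsub ρ) (hsup ρ) (sign_mul_mem_Icc hσ ht) (by linarith)
  · refine ⟨hρs.1, hρs.2, hac, hnormal, fun ρ hρ => ?_, fun ρ hρ h1 => ?_, fun ρ hρ h2 => ?_⟩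
    · rcases le_or_gt ρ ρs with hle | hlt
      · exact Or.inl (hone ρ hρ hle)
      · exact Or.inr (htwo ρ (hpos hρ hlt) hlt)
    · by_contra hlt
      rw [not_le] at hlt
      rw [htwo ρ (hpos hρ hlt) hlt] at h1
      norm_num at h1
    · rcases le_or_gt ρ ρs with hle | hlt
      · rw [hone ρ hρ hle] at h2
        norm_num at h2
      · obtain ⟨h3, h4⟩ := hpair ρ (hpos hρ hlt) hlt
        obtain ⟨h5, h6⟩ := hpair ρss ⟨hρss, le_rfl⟩ hρs.2
        refine ⟨hlt.le, ?_⟩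
        rw [h3, h5]
        exact persistent_pair h6 h4 (inter_subset_inter_left _ (hanti hρ.2))
          (inter_subset_inter_left _ (hanti hρ.2))
  · rintro ε ⟨hε, hε'⟩
    have hlt : ρs < ρs + ε := by linarith
    have hρ : ρs + ε ∈ Ioc 0 ρss := ⟨by linarith [hρs.1], by linarith⟩
    obtain ⟨fm, fp, am, bm, ap, bp, e⟩ := henv _ hρ
    have h0 : fp 0 < 0 := not_le.1 fun h0 => absurd ((hlow _ hρ _ _ _ _ _ _ e).1 h0) hlt.not_ge
    obtain ⟨l, hl, r, hr, hfl, hfr, hτ⟩ := e.exists_tauStar_eq h0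
    have haxis : ∀ x ∈ Icc (-0.2 : ℝ) 0.2, fp x = 0 → |ε - x ^ 2| ≤ K * x ^ 2 := by
      intro x hx' hfx
      have hxI : x ∈ Icc (-1 : ℝ) 1 := ⟨by linarith [hx'.1], by linarith [hx'.2]⟩
      have hval := e.eq_on_upper hcont (hsub _) (hsup _) hxI hfx.ge
      rw [hfx] at hval
      have hmem : (x, (0 : ℝ)) ∈ posSet h :=
        ⟨⟨hxI, by norm_num, by norm_num⟩, by rw [hval]; exact hρ.1⟩
      have := hsaddle x 0 hmem hx' ⟨by norm_num, by norm_num⟩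
      rw [hval] at this
      simpa using this
    obtain ⟨hr1, hr2⟩ := abscissa_bounds hK hr.1 (haxis r ⟨by linarith [hr.1], hr.2.le⟩ hfr)
    obtain ⟨hl1, hl2⟩ := abscissa_bounds (r := -l) hK (by linarith [hl.2])
      (by simpa using haxis l ⟨hl.1.le, by linarith [hl.2]⟩ hfl)
    have hcomm : ∀ s : ℝ, 2 / s * √ε = 2 * (√ε / s) := fun s => by ring
    rw [hτ, hcomm, hcomm]
    exact ⟨ENNReal.ofReal_le_ofReal (by linarith), ENNReal.ofReal_le_ofReal (by linarith)⟩
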